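/- Let $\mathcal A$ be a unital $\mathbb C$-algebra with a linear functional $\varphi$, $\varphi(1)=1$, and let $\mathcal F$ be a (not necessarily unital) $\mathbb C$-algebra with a linear functional $\Phi$, such that $\mathcal F$ is an $\mathcal A$-bimodule in a way compatible with its multiplication. Let $\mathcal B=\mathcal A\oplus\mathcal F$ be the unital algebra with product $(a_1,f_1)(a_2,f_2)=(a_1a_2,\,a_1f_2+f_1a_2+f_1f_2)$, write $a+f$ for $(a,f)$, and put $\varphi(a+f)=\varphi(a)$, $\varphi'(a+f)=\Phi(f)$. A *distribution* is a linear functional $\mathbb C[x]\to\mathbb C$; the distribution of $b\in\mathcal B$ with respect to $\psi\in\{\varphi,\varphi'\}$ is $x^n\mapsto\psi(b^n)$, $n\ge 0$, and the infinitesimal distribution of $b$ is the pair of its distributions with respect to $\varphi$ and $\varphi'$. Elements $a\in\mathcal A$, $f\in\mathcal F$ are *cyclic-antimonotone independent* if $$\Phi(a_0f_1a_1f_2\cdots a_{n-1}f_na_n)=\varphi(a_0a_n)\Big[\prod_{1\le i\le n-1}\varphi(a_i)\Big]\Phi(f_1f_2\cdots f_n)$$ for all $n\ge1$, all $a_0,\dots,a_n$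 in the unital subalgebra generated by $a$ and all $f_1,\dots,f_n$ in the (non-unital) subalgebra generated by $f$. An *infinitesimal noncommutative probability space* is a unital $\mathbb C$-algebra $\mathcal C$ with linear functionals $\phi,\phi'$ such that $\phi(1)=1$, $\phi'(1)=0$. Unital subalgebras $(\mathcal C_i)_{i\in I}$ are *infinitesimally free* if, whenever $n\ge 1$, $i_1\ne i_2\ne\cdots\ne i_n$, $b_j\in\mathcal C_{i_j}$ and $\phi(b_j)=0$ for all $j$, one has $\phi(b_1\cdots b_n)=0$, and $\phi'(b_1\cdots b_n)$ equals $\phi(b_1b_n)\phi(b_2b_{n-1})\cdots\phi(b_{(n-1)/2}b_{(n+3)/2})\,\phi'(b_{(n+1)/2})$ if $n$ is odd and $i_j=i_{n+1-j}$ for all $j$, and equals $0$ otherwise; two elements are infinitesimally free if the unital subalgebras they generate are. The *infinitesimal free convolution* of $(\mu_1,\mu_1')$ and $(\mu_2,\mu_2')$ has as its second component the distribution with respect to $\phi'$ of $b_1+b_2$, where $b_1,b_2$ are infinitesimally free with infinitesimal distributions $(\mu_1,\mu_1')$ and $(\mu_2,\mu_2')$. **Corollary.** Let $a\in\mathcal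 A$ and $f\in\mathcal F$ be cyclic-antimonotone independent, let $\mu$ be the distribution of $a$ with respect to $\varphi$ and $\nu$ the distribution of $f$ with respect to $\varphi'$. Then the infinitesimal distribution of $a+f$ with respect to $(\varphi,\varphi')$ is $(\mu,\mu\lhd_{c}\nu)$, where the distribution $\mu\lhd_{c}\nu$, called the *cyclic-antimonotone convolution* of $\mu$ and $\nu$, depends only on $\mu$ and $\nu$. It is defined for all distributions $\mu,\nu$ with $\mu(1)=1$, $\nu(1)=0$ (each such pair arises from some such $a$ and $f$). For all such $\mu,\nu$, the second component of the infinitesimal free convolution of $(\mu,0)$ and $(\delta_0,\nu)$, where $\delta_0(p)=p(0)$, exists, depends only on $\mu$ and $\nu$, and equals $\mu\lhd_{c}\nu$. Moreover, $\mu\lhd_{c}\nu$ is the unique distribution such that, as formal Laurent series in $1/z$, $$G_{\mu\lhd_{c}\nu}(z)=G_\nu(F_\mu(z))\,F_\mu'(z),$$ where $G_\rho(z)=\sum_{n\ge0}\rho(x^n)z^{-n-1}$ and $F_\mu(z)=1/G_\mu(z)$. -/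

import Mathlib

open Polynomial
open scoped LaurentSeries

noncomputable section

/-! ## Distributions and formal Cauchy transforms -/

/-- A distribution: a linear functional on `ℂ[x]`. -/
abbrev NCDistribution : Type := ℂ[X] →ₗ[ℂ] ℂ

/-- The distribution `δ₀ : p ↦ p(0)`. -/
def deltaZero : NCDistribution := (aeval (0 : ℂ)).toLinearMap

/-- The power series `∑ₙ μ(xⁿ) wⁿ⁺¹`, i.e. the Cauchy transform of `μ` in the variable `w = 1/z`. -/
def cauchySeries (μ : NCDistribution) : PowerSeries ℂ :=
  PowerSeries.X * PowerSeries.mk fun n => μ (X ^ n)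

/-- The Cauchy transform `G_μ(z) = ∑ₙ μ(xⁿ) / zⁿ⁺¹`, as a formal Laurent series in `w = 1/z`. -/
def cauchyTransform (μ : NCDistribution) : ℂ⸨X⸩ := HahnSeries.ofPowerSeries ℤ ℂ (cauchySeries μ)

/-- The reciprocal Cauchy transform `F_μ(z) = 1 / G_μ(z)`, in the field of formal Laurent series
in `w = 1/z`. -/
def reciprocalCauchy (μ : NCDistribution) : ℂ⸨X⸩ := (cauchyTransform μ)⁻¹

/-- The composition `G_ν(H(z)) = ∑ₙ ν(xⁿ) / H(z)ⁿ⁺¹`, for a formal Laurent series `H` in `w = 1/z`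
such that `1/H` has positive order in `w` (so that the sum makes sense): the power series in the
reciprocal of the argument is evaluated at `1/H`. -/
def cauchyComp (ν : NCDistribution) (H : ℂ⸨X⸩) : ℂ⸨X⸩ :=
  PowerSeries.heval H⁻¹ (cauchySeries ν)

/-- The derivative `d/dz` of a formal Laurent series written in the variable `w = 1/z`:
`d/dz = -w² d/dw`. -/
def derivZ (H : ℂ⸨X⸩) : ℂ⸨X⸩ := -(HahnSeries.single 2 1 * LaurentSeries.derivative ℂ H)

/-- The distribution `p ↦ ψ(p(b))` of an element `b` with respect to a linear functional `ψ`. -/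
def distributionOf {B : Type*} [Ring B] [Algebra ℂ B] (ψ : B →ₗ[ℂ] ℂ) (b : B) : NCDistribution :=
  ψ ∘ₗ (aeval b).toLinearMap

/-! ## Infinitesimal noncommutative probability spaces -/

/-- An infinitesimal noncommutative probability space `(B, φ, φ')`. -/
structure InfNCPS.{u} where
  B : Type u
  [ring : Ring B]
  [algebra : Algebra ℂ B]
  φ : B →ₗ[ℂ] ℂ
  φ' : B →ₗ[ℂ] ℂ
  φ_one : φ 1 = 1
  φ'_one : φ' 1 = 0

attribute [instance] InfNCPS.ring InfNCPS.algebra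

namespace InfNCPS

/-- The infinitesimal distribution of `b` with respect to `(φ, φ')`. -/
def infDistribution (S : InfNCPS) (b : S.B) : NCDistribution × NCDistribution :=
  (distributionOf S.φ b, distributionOf S.φ' b)

/-- Infinitesimal freeness of a family of unital subalgebras. The indices of the `n` factors are
`0, …, n - 1`, so the factor `j` is paired with the factor `n - 1 - j = Fin.rev j`, and for odd `n`
the middle factor is the one of index `n / 2`. -/
def InfFree (S : InfNCPS) {I : Type*} (C : I → Subalgebra ℂ S.B) : Prop :=
  ∀ (n : ℕ) (hn : 0 < n) (i : Fin n → I) (b : Fin n → S.B),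
    (∀ j k : Fin n, (j : ℕ) + 1 = k → i j ≠ i k) →
    (∀ j, b j ∈ C (i j)) → (∀ j, S.φ (b j) = 0) →
    S.φ (List.ofFn b).prod = 0 ∧
    ((Odd n ∧ ∀ j, i j = i j.rev) →
      S.φ' (List.ofFn b).prod =
        (∏ j ∈ Finset.univ.filter (fun j : Fin n => (j : ℕ) < n / 2), S.φ (b j * b j.rev)) *
          S.φ' (b ⟨n / 2, Nat.div_lt_self hn one_lt_two⟩)) ∧
    (¬(Odd n ∧ ∀ j, i j = i j.rev) → S.φ' (List.ofFn b).prod = 0)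

/-- Two elements are infinitesimally free if the unital subalgebras that they generate are. -/
def ElemInfFree (S : InfNCPS) (b₁ b₂ : S.B) : Prop :=
  S.InfFree ![Algebra.adjoin ℂ {b₁}, Algebra.adjoin ℂ {b₂}]

end InfNCPS

/-- `ρ` is the distribution with respect to `φ'` of a sum `b₁ + b₂` of infinitesimally free elements
of infinitesimal distributions `(μ₁, μ₁')` and `(μ₂, μ₂')`. -/
def IsInfFreeConv (μ₁' μ₁ μ₂ μ₂' ρ : NCDistribution) : Prop :=
  ∃ (S : InfNCPS.{0}) (b₁ b₂ : S.B), S.ElemInfFree b₁ b₂ ∧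
    S.infDistribution b₁ = (μ₁, μ₁') ∧ S.infDistribution b₂ = (μ₂, μ₂') ∧
    distributionOf S.φ' (b₁ + b₂) = ρ

/-- The infinitesimal free convolution: the distribution with respect to `φ'` of a sum of
infinitesimally free elements of infinitesimal distributions `(μ₁, μ₁')` and `(μ₂, μ₂')`. -/
def infFreeConv (μ₁' μ₁ μ₂ μ₂' : NCDistribution) : NCDistribution :=
  Classical.epsilon (IsInfFreeConv μ₁' μ₁ μ₂ μ₂')

/-! ## Noncommutative probability spaces of type B′ -/

/-- A noncommutative probability space of type B′, `(A, φ, F, Φ)`: a unital algebra `A` with a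
unital linear functional `φ`, and a (not necessarily unital) algebra `F` with a linear functional
`Φ`, where `F` is an `A`-bimodule in a way consistent with its multiplication. The right action
`f · a` is written `MulOpposite.op a • f`. -/
structure TypeBPrimeNCPS.{u, v} where
  A : Type u
  F : Type v
  [ringA : Ring A]
  [algebraA : Algebra ℂ A]
  [ringF : NonUnitalRing F]
  [moduleF : Module ℂ F]
  [towerF : IsScalarTower ℂ F F]
  [commF : SMulCommClass ℂ F F]
  [leftModule : Module A F]
  [rightModule : Module Aᵐᵒᵖ F]
  [leftTower : IsScalarTower ℂ A F]
  [rightTower : IsScalarTower ℂ Aᵐᵒᵖ F]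
  [bimodule : SMulCommClass A Aᵐᵒᵖ F]
  smul_mul : ∀ (a : A) (f g : F), (a • f) * g = a • (f * g)
  mul_op_smul : ∀ (a : A) (f g : F), f * (MulOpposite.op a • g) = MulOpposite.op a • (f * g)
  op_smul_mul : ∀ (a : A) (f g : F), (MulOpposite.op a • f) * g = f * (a • g)
  φ : A →ₗ[ℂ] ℂ
  φ_one : φ 1 = 1
  Φ : F →ₗ[ℂ] ℂ

attribute [instance] TypeBPrimeNCPS.ringA TypeBPrimeNCPS.algebraA TypeBPrimeNCPS.ringF
  TypeBPrimeNCPS.moduleF TypeBPrimeNCPS.towerF TypeBPrimeNCPS.commF TypeBPrimeNCPS.leftModule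
  TypeBPrimeNCPS.rightModule TypeBPrimeNCPS.leftTower TypeBPrimeNCPS.rightTower
  TypeBPrimeNCPS.bimodule

namespace TypeBPrimeNCPS

/-- The underlying space `A ⊕ F` of the algebra `A⟨F⟩`. -/
def Alg (S : TypeBPrimeNCPS) : Type _ := S.A × S.F

instance (S : TypeBPrimeNCPS) : AddCommGroup S.Alg := inferInstanceAs (AddCommGroup (S.A × S.F))

instance (S : TypeBPrimeNCPS) : Module ℂ S.Alg := inferInstanceAs (Module ℂ (S.A × S.F))

/-- `(a₁, f₁) (a₂, f₂) = (a₁ a₂, a₁ f₂ + f₁ a₂ + f₁ f₂)`. -/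
instance (S : TypeBPrimeNCPS) : Mul S.Alg :=
  ⟨fun x y => (x.1 * y.1, x.1 • y.2 + MulOpposite.op y.1 • x.2 + x.2 * y.2)⟩

instance (S : TypeBPrimeNCPS) : One S.Alg := ⟨((1 : S.A), (0 : S.F))⟩

theorem alg_ext {S : TypeBPrimeNCPS} {x y : S.Alg} (h₁ : x.1 = y.1) (h₂ : x.2 = y.2) : x = y :=
  Prod.ext h₁ h₂

theorem mul_fst {S : TypeBPrimeNCPS} (x y : S.Alg) : (x * y).1 = x.1 * y.1 := rfl

theorem mul_snd {S : TypeBPrimeNCPS} (x y : S.Alg) :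
    (x * y).2 = x.1 • y.2 + MulOpposite.op y.1 • x.2 + x.2 * y.2 := rfl

theorem one_fst {S : TypeBPrimeNCPS} : (1 : S.Alg).1 = 1 := rfl

theorem one_snd {S : TypeBPrimeNCPS} : (1 : S.Alg).2 = 0 := rfl

theorem add_fst {S : TypeBPrimeNCPS} (x y : S.Alg) : (x + y).1 = x.1 + y.1 := rfl

theorem add_snd {S : TypeBPrimeNCPS} (x y : S.Alg) : (x + y).2 = x.2 + y.2 := rfl

theorem zero_fst {S : TypeBPrimeNCPS} : (0 : S.Alg).1 = 0 := rfl

theorem zero_snd {S : TypeBPrimeNCPS} : (0 : S.Alg).2 = 0 := rfl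

theorem smul_fst {S : TypeBPrimeNCPS} (c : ℂ) (x : S.Alg) : (c • x).1 = c • x.1 := rfl

theorem smul_snd {S : TypeBPrimeNCPS} (c : ℂ) (x : S.Alg) : (c • x).2 = c • x.2 := rfl

instance (S : TypeBPrimeNCPS) : Ring S.Alg :=
  { (inferInstance : AddCommGroup S.Alg), (inferInstance : Mul S.Alg),
    (inferInstance : One S.Alg) with
    left_distrib := fun x y z => alg_ext (by simp [mul_fst, add_fst, mul_add])
      (by simp only [mul_snd, add_fst, add_snd, mul_add, smul_add, add_smul, MulOpposite.op_add]
          abel)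
    right_distrib := fun x y z => alg_ext (by simp [mul_fst, add_fst, add_mul])
      (by simp only [mul_snd, add_fst, add_snd, add_mul, smul_add, add_smul]
          abel)
    zero_mul := fun x => alg_ext (by simp [mul_fst, zero_fst])
      (by simp [mul_snd, zero_fst, zero_snd])
    mul_zero := fun x => alg_ext (by simp [mul_fst, zero_fst])
      (by simp [mul_snd, zero_fst, zero_snd])
    one_mul := fun x => alg_ext (by simp [mul_fst, one_fst])
      (by simp [mul_snd, one_fst, one_snd])
    mul_one := fun x => alg_ext (by simp [mul_fst, one_fst])
      (by simp [mul_snd, one_fst, one_snd])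
    mul_assoc := fun x y z => alg_ext (by simp [mul_fst, mul_assoc])
      (by
        have h : MulOpposite.op z.1 • x.1 • y.2 = x.1 • MulOpposite.op z.1 • y.2 :=
          (smul_comm _ _ _).symm
        simp only [mul_snd, mul_fst, smul_add, add_mul, mul_add, MulOpposite.op_mul, mul_smul,
          S.smul_mul, S.mul_op_smul, S.op_smul_mul, mul_assoc, h]
        abel)
    neg_add_cancel := fun x => neg_add_cancel x
    zsmul := fun n x => n • x
    nsmul := fun n x => n • x }

instance (S : TypeBPrimeNCPS) : Algebra ℂ S.Alg :=
  Algebra.ofModule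
    (fun c x y => alg_ext (by simp [mul_fst, smul_fst])
      (by
        have h : MulOpposite.op y.1 • c • x.2 = c • MulOpposite.op y.1 • x.2 := smul_comm _ _ _
        simp only [mul_snd, smul_fst, smul_snd, smul_add, smul_assoc, smul_mul_assoc, h]))
    (fun c x y => alg_ext (by simp [mul_fst, smul_fst])
      (by
        have h : x.1 • c • y.2 = c • x.1 • y.2 := smul_comm _ _ _
        simp only [mul_snd, smul_fst, smul_snd, smul_add, smul_assoc, mul_smul_comm,
          MulOpposite.op_smul, h]))

/-- The embedding of `A` into `A⟨F⟩`. -/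
def ofA (S : TypeBPrimeNCPS) (a : S.A) : S.Alg := (a, 0)

/-- The embedding of `F` into `A⟨F⟩`. -/
def ofF (S : TypeBPrimeNCPS) (f : S.F) : S.Alg := (0, f)

theorem ofA_fst {S : TypeBPrimeNCPS} (a : S.A) : (S.ofA a).1 = a := rfl

theorem ofA_snd {S : TypeBPrimeNCPS} (a : S.A) : (S.ofA a).2 = 0 := rfl

theorem ofF_fst {S : TypeBPrimeNCPS} (f : S.F) : (S.ofF f).1 = 0 := rfl

theorem ofF_snd {S : TypeBPrimeNCPS} (f : S.F) : (S.ofF f).2 = f := rfl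

/-- The infinitesimal noncommutative probability space `(A⟨F⟩, φ, φ')` associated with
`(A, φ, F, Φ)`: `φ(a + f) = φ(a)` and `φ'(a + f) = Φ(f)`. -/
def toInf (S : TypeBPrimeNCPS) : InfNCPS where
  B := S.Alg
  φ := S.φ ∘ₗ LinearMap.fst ℂ S.A S.F
  φ' := S.Φ ∘ₗ LinearMap.snd ℂ S.A S.F
  φ_one := S.φ_one
  φ'_one := map_zero S.Φ

theorem toInf_φ {S : TypeBPrimeNCPS} (x : S.Alg) : S.toInf.φ x = S.φ x.1 := rfl

theorem toInf_φ' {S : TypeBPrimeNCPS} (x : S.Alg) : S.toInf.φ' x = S.Φ x.2 := rfl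

/-- Cyclic-antimonotone independence of a unital subalgebra `A₁` of `A` and a subalgebra `F₁` of
`F`: for all `m = n + 1 ≥ 1`, `a₀, …, a_m ∈ A₁` and `f₁, …, f_m ∈ F₁`,
`Φ(a₀ f₁ a₁ f₂ ⋯ a_{m-1} f_m a_m) = φ(a₀ a_m) φ(a₁) ⋯ φ(a_{m-1}) Φ(f₁ f₂ ⋯ f_m)`.
The two products are formed in `A⟨F⟩`; they lie in `F`, where `φ'` is `Φ`. -/
def CyclicAntimonotone (S : TypeBPrimeNCPS) (A₁ : Subalgebra ℂ S.A)
    (F₁ : NonUnitalSubalgebra ℂ S.F) : Prop :=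
  ∀ (n : ℕ) (a : Fin (n + 2) → S.A) (f : Fin (n + 1) → S.F),
    (∀ k, a k ∈ A₁) → (∀ k, f k ∈ F₁) →
    S.toInf.φ' (S.ofA (a 0) *
        (List.ofFn fun k : Fin (n + 1) => S.ofF (f k) * S.ofA (a k.succ)).prod) =
      S.φ (a 0 * a (Fin.last (n + 1))) * (∏ k : Fin n, S.φ (a k.succ.castSucc)) *
        S.toInf.φ' (List.ofFn fun k : Fin (n + 1) => S.ofF (f k)).prod

/-- Two elements `a ∈ A` and `f ∈ F` are cyclic-antimonotone independent if the unital subalgebra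
generated by `a` and the (not necessarily unital) subalgebra generated by `f` are. -/
def ElemCyclicAntimonotone (S : TypeBPrimeNCPS) (a : S.A) (f : S.F) : Prop :=
  S.CyclicAntimonotone (Algebra.adjoin ℂ {a}) (NonUnitalAlgebra.adjoin ℂ {f})

end TypeBPrimeNCPS

/-- `ρ` is the distribution with respect to `φ'` of a sum `a + f`, where `a ∈ A` and `f ∈ F` are
cyclic-antimonotone independent, `a` has distribution `μ` with respect to `φ` and `f` has
distribution `ν` with respect to `φ'`. -/
def IsCyclicAntimonotoneConv (μ ν ρ : NCDistribution) : Prop :=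
  ∃ (S : TypeBPrimeNCPS.{0, 0}) (a : S.A) (f : S.F), S.ElemCyclicAntimonotone a f ∧
    distributionOf S.φ a = μ ∧ distributionOf S.toInf.φ' (S.ofF f) = ν ∧
    distributionOf S.toInf.φ' (S.ofA a + S.ofF f) = ρ

/-- The cyclic-antimonotone convolution of `μ` and `ν`: the distribution with respect to `φ'` of a
sum `a + f` of cyclic-antimonotone independent `a ∈ A` and `f ∈ F` of distributions `μ` and `ν`. -/
def cyclicAntimonotoneConv (μ ν : NCDistribution) : NCDistribution :=
  Classical.epsilon (IsCyclicAntimonotoneConv μ ν)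

end

universe u v

/-! Everything rests on one formula: on a word with `k ≥ 1` letters `f`, `φ'(a^p f a^{i₁} f ⋯ f a^q)
= μ(x^{p+q}) ∏ μ(x^{iⱼ}) ν(x^k)`, while `φ'(a^n) = 0`. Put `w = 1/z` and `G = G_μ = w M(w)`. Summed
over all words, weighted by `w` to the length plus one, each of the `k - 1` interior gaps
contributes `M`. The outer pair contributes `∑ (i+1) μ(x^i) w^i = G'(w)`, because `p + q = i` has `i
+ 1` solutions. So `φ'((a+f)^n)` has generating series `w² G' ∑_{k≥1} ν(x^k) G^{k-1}`
(`cyclicConvSeries`). Since `d/dz = -w² d/dw`, `F_μ' = w² G'/G²`, and as `ν(1) = 0` this series is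
`G_ν(F_μ) F_μ'`.

The word formula is proved for infinitesimally free `a`, `f` with infinitesimal distributions `(μ,
0)` and `(δ₀, ν)` (`InfFree.φ'_block_word`). The functional `φ` kills every product of two centered
elements generated by `f`, so a word with a centered `a`-letter between two powers of `f` has `φ'`
zero. Each interior `a`-letter may therefore be replaced by its expectation. Cyclic-antimonotone
independence is reduced to this case: such `a` and `f` are infinitesimally free in `A⟨F⟩`
(`ElemCyclicAntimonotone.alternating_word`).

Existence comes from a model on `ℂ[x] ⊗ ℂ[y] ⊗ ℂ[x]`, where multiplication contracts the two
adjacent outer legs by `μ` and the trace is `a ⊗ g ⊗ b ↦ μ(ab) ν(g)`. Uniqueness and the equality of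
the two convolutions follow because a distribution is determined by its Cauchy transform. -/

/-! ### Formal Cauchy transforms and composition of series -/

theorem NCDistribution.ext_moments {ρ σ : NCDistribution} (h : ∀ n : ℕ, ρ (X ^ n) = σ (X ^ n)) :
    ρ = σ := by
  refine Polynomial.lhom_ext' fun n => LinearMap.ext_ring ?_
  simpa [← Polynomial.X_pow_eq_monomial] using h n

theorem coeff_succ_cauchySeries (ρ : NCDistribution) (n : ℕ) :
    PowerSeries.coeff (n + 1) (cauchySeries ρ) = ρ (X ^ n) := by
  simp [cauchySeries, PowerSeries.coeff_succ_X_mul]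

theorem coeff_zero_cauchySeries (ρ : NCDistribution) :
    PowerSeries.coeff 0 (cauchySeries ρ) = 0 := by
  simp [cauchySeries]

theorem cauchyTransform_injective : Function.Injective cauchyTransform := by
  intro ρ σ h
  have h' := HahnSeries.ofPowerSeries_injective (Γ := ℤ) (R := ℂ) h
  refine NCDistribution.ext_moments fun n => ?_
  rw [← coeff_succ_cauchySeries, ← coeff_succ_cauchySeries, h']

theorem PowerSeries.coeff_pow_eq_zero_of_lt {R : Type*} [CommSemiring R] {g : PowerSeries R}
    (hg : PowerSeries.coeff 0 g = 0) {n k : ℕ} (h : n < k) : PowerSeries.coeff n (g ^ k) = 0 := by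
  obtain ⟨M, rfl⟩ := PowerSeries.X_dvd_iff.2 (by simpa using hg)
  rw [mul_pow, PowerSeries.coeff_X_pow_mul', if_neg (by omega)]

/-- The composition `∑ₖ cₖ gᵏ` for a power series `g` without constant term. -/
noncomputable def compSeries (c : ℕ → ℂ) (g : PowerSeries ℂ) : PowerSeries ℂ :=
  PowerSeries.mk fun n => ∑ k ∈ Finset.range (n + 1), c k * PowerSeries.coeff n (g ^ k)

/-- Since `g ^ k` has order at least `k`, the truncation in `compSeries` may be moved from the index
of each factor to the common bound `n`. -/
theorem coeff_mul_compSeries (c : ℕ → ℂ) {g : PowerSeries ℂ} (hg : PowerSeries.coeff 0 g = 0)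
    (p : PowerSeries ℂ) (n : ℕ) :
    PowerSeries.coeff n (p * compSeries c g) =
      ∑ k ∈ Finset.range (n + 1), c k * PowerSeries.coeff n (p * g ^ k) := by
  simp only [PowerSeries.coeff_mul, compSeries, PowerSeries.coeff_mk, Finset.mul_sum]
  rw [Finset.sum_comm' (t' := Finset.range (n + 1)) (s' := fun k =>
    (Finset.HasAntidiagonal.antidiagonal n).filter fun x => k < x.2 + 1)]
  · refine Finset.sum_congr rfl fun k _ => ?_
    rw [Finset.sum_filter]
    refine Finset.sum_congr rfl fun x _ => ?_
    split_ifs with h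
    · ring
    · rw [PowerSeries.coeff_pow_eq_zero_of_lt hg (by omega)]
      simp
  · rintro ⟨i, j⟩ k
    simp only [Finset.HasAntidiagonal.mem_antidiagonal, Finset.mem_range, Finset.mem_filter]
    omega

theorem ofPowerSeries_orderTop_pos {g : PowerSeries ℂ} (hg : PowerSeries.coeff 0 g = 0) :
    0 < (HahnSeries.ofPowerSeries ℤ ℂ g).orderTop := by
  by_contra! h
  obtain ⟨i, hi⟩ := WithTop.ne_top_iff_exists.1 (ne_top_of_le_ne_top WithTop.zero_ne_top h)
  rw [← hi] at h
  have hi0 : i ≤ 0 := by exact_mod_cast h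
  refine HahnSeries.coeff_orderTop_ne hi.symm ?_
  rw [PowerSeries.coeff_coe]
  split_ifs with h0
  · rfl
  · rw [le_antisymm hi0 (not_lt.1 h0), Int.natAbs_zero, hg]

/-- Positive order makes the family of powers of `g` summable, and only `k ≤ n` contributes to the
coefficient of index `n`. This moves the composition from Laurent series to power series. -/
theorem heval_ofPowerSeries (c : ℕ → ℂ) {g : PowerSeries ℂ} (hg : PowerSeries.coeff 0 g = 0) :
    PowerSeries.heval (HahnSeries.ofPowerSeries ℤ ℂ g) (PowerSeries.mk c) =
      HahnSeries.ofPowerSeries ℤ ℂ (compSeries c g) := by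
  have hpos := ofPowerSeries_orderTop_pos hg
  ext n
  rw [PowerSeries.coeff_heval]
  have : ∀ k, ((HahnSeries.SummableFamily.powerSeriesFamily (HahnSeries.ofPowerSeries ℤ ℂ g)
      (PowerSeries.mk c) k)).coeff n = c k * (HahnSeries.ofPowerSeries ℤ ℂ (g ^ k)).coeff n := by
    intro k
    rw [HahnSeries.SummableFamily.powerSeriesFamily_of_orderTop_pos hpos]
    simp
  refine (finsum_congr this).trans ?_
  rw [PowerSeries.coeff_coe]
  simp only [PowerSeries.coeff_coe]
  split_ifs with h
  · simp
  · rw [compSeries, PowerSeries.coeff_mk]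
    refine finsum_eq_finsetSum_of_support_subset _ fun k hk => ?_
    by_contra hk'
    refine hk ?_
    simp only [Finset.coe_range, Set.mem_Iio, not_lt] at hk'
    change c k * _ = 0
    rw [PowerSeries.coeff_pow_eq_zero_of_lt hg (by omega), mul_zero]

/-- With `N = M⁻¹`, the inverse is `w⁻¹ N`, which has a pole, and `-w² (w⁻¹ N)' = N - w N'`. This
equals `M⁻² (w M)'` because `N' = -N² M'`. -/
theorem derivZ_inv_ofPowerSeries {M : PowerSeries ℂ} (hM : PowerSeries.constantCoeff M ≠ 0) :
    derivZ (HahnSeries.ofPowerSeries ℤ ℂ (PowerSeries.X * M))⁻¹ =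
      HahnSeries.ofPowerSeries ℤ ℂ
        (M⁻¹ ^ 2 * PowerSeries.derivative ℂ (PowerSeries.X * M)) := by
  have hMM : M * M⁻¹ = 1 := PowerSeries.mul_inv_cancel M hM
  have hinv : (HahnSeries.ofPowerSeries ℤ ℂ (PowerSeries.X * M))⁻¹ =
      HahnSeries.single (-1) 1 * HahnSeries.ofPowerSeries ℤ ℂ M⁻¹ := by
    refine inv_eq_of_mul_eq_one_right ?_
    rw [map_mul, HahnSeries.ofPowerSeries_X, mul_mul_mul_comm, ← map_mul, hMM,
      HahnSeries.single_mul_single]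
    simp
  have hder : M⁻¹ ^ 2 * PowerSeries.derivative ℂ (PowerSeries.X * M) =
      M⁻¹ - PowerSeries.X * PowerSeries.derivative ℂ M⁻¹ := by
    rw [PowerSeries.derivative_inv', Derivation.leibniz, PowerSeries.derivative_X]
    simp only [smul_eq_mul]
    linear_combination M⁻¹ * hMM
  rw [hder, hinv, derivZ]
  ext n
  rw [HahnSeries.coeff_neg, map_sub, HahnSeries.coeff_sub, map_mul (HahnSeries.ofPowerSeries ℤ ℂ),
    HahnSeries.ofPowerSeries_X]
  have hshift : ∀ (y : ℂ⸨X⸩) (a m : ℤ),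
      (HahnSeries.single a (1 : ℂ) * y).coeff m = y.coeff (m - a) := by
    intro y a m
    have := HahnSeries.coeff_single_mul_add (r := (1 : ℂ)) (x := y) (a := m - a) (b := a)
    simpa using this
  rw [hshift, hshift, LaurentSeries.derivative_apply, LaurentSeries.hasseDeriv_coeff, hshift]
  simp only [PowerSeries.coeff_coe]
  have hn : n - 2 + ((1 : ℕ) : ℤ) - -1 = n := by push_cast; ring
  rw [hn, Ring.choose_one_right]
  -- The claim is `-(n - 1) Nₙ = Nₙ - n Nₙ`. Negative `n` gives zero on both sides, and `n = 0` is
  -- separate because `w N'` has no constant term.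
  rcases lt_trichotomy n 0 with h | rfl | h
  · rw [if_pos h, if_pos (by omega)]
    simp
  · simp
  · obtain ⟨m, rfl⟩ : ∃ m : ℕ, n = m + 1 := ⟨(n - 1).toNat, by omega⟩
    rw [if_neg (by omega), if_neg (by omega), add_sub_cancel_right, Int.natAbs_natCast,
      show ((m : ℤ) + 1).natAbs = m + 1 by omega, PowerSeries.coeff_derivative,
      show (m : ℤ) + 1 - 2 + ((1 : ℕ) : ℤ) = m by push_cast; ring]
    simp only [zsmul_eq_mul, Int.cast_natCast]
    ring

/-- The Cauchy transform, as a power series in `1/z`, of the cyclic-antimonotone convolution. -/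
noncomputable def cyclicConvSeries (μ ν : NCDistribution) : PowerSeries ℂ :=
  PowerSeries.X ^ 2 * (PowerSeries.derivative ℂ (cauchySeries μ) *
    compSeries (fun k => ν (X ^ (k + 1))) (cauchySeries μ))

/-- `ν 1 = 0` makes `G_ν` divisible by the square of its variable, which cancels the `1/G²` in `F_μ'
= w² G'/G²`. `μ 1 = 1` makes `M = G/w` invertible. -/
theorem cauchyComp_mul_derivZ {μ ν : NCDistribution} (hμ : μ 1 = 1) (hν : ν 1 = 0) :
    cauchyComp ν (reciprocalCauchy μ) * derivZ (reciprocalCauchy μ) =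
      HahnSeries.ofPowerSeries ℤ ℂ (cyclicConvSeries μ ν) := by
  set M : PowerSeries ℂ := PowerSeries.mk fun n => μ (X ^ n) with hM
  have hG : cauchySeries μ = PowerSeries.X * M := rfl
  have hc : PowerSeries.constantCoeff M ≠ 0 := by simp [hM, hμ]
  have hMM : M * M⁻¹ = 1 := PowerSeries.mul_inv_cancel M hc
  have hNu : cauchySeries ν =
      PowerSeries.X ^ 2 * PowerSeries.mk fun k => ν (X ^ (k + 1)) := by
    ext n
    rcases n with _ | _ | n
    · simp [coeff_zero_cauchySeries]
    · rw [coeff_succ_cauchySeries, PowerSeries.coeff_X_pow_mul']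
      simp [hν]
    · rw [coeff_succ_cauchySeries, add_assoc n 1 1, PowerSeries.coeff_X_pow_mul]
      simp
  have hevX : PowerSeries.heval (HahnSeries.ofPowerSeries ℤ ℂ (cauchySeries μ)) PowerSeries.X =
      HahnSeries.ofPowerSeries ℤ ℂ (cauchySeries μ) :=
    PowerSeries.heval_X _ (ofPowerSeries_orderTop_pos (coeff_zero_cauchySeries μ))
  rw [cauchyComp, reciprocalCauchy, inv_inv, cauchyTransform, hNu, map_mul, map_pow, hevX,
    heval_ofPowerSeries _ (coeff_zero_cauchySeries μ), cyclicConvSeries, hG,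
    derivZ_inv_ofPowerSeries hc]
  simp only [← map_mul, ← map_pow]
  congr 1
  -- What remains is `(M M⁻¹)² = 1`, factored as `(M M⁻¹ - 1)(M M⁻¹ + 1) = 0`.
  linear_combination (PowerSeries.X ^ 2 * compSeries (fun k => ν (X ^ (k + 1))) (PowerSeries.X * M)
    * PowerSeries.derivative ℂ (PowerSeries.X * M)) * (M * M⁻¹ + 1) * hMM

/-! ### Moments of `a + f` from the values on words -/

theorem compSeries_eq (c : ℕ → ℂ) {g : PowerSeries ℂ} (hg : PowerSeries.coeff 0 g = 0) :
    compSeries c g = PowerSeries.C (c 0) + g * compSeries (fun k => c (k + 1)) g := by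
  ext n
  rw [map_add, coeff_mul_compSeries _ hg]
  simp only [compSeries, PowerSeries.coeff_mk, ← pow_succ']
  rw [Finset.sum_range_succ', Finset.sum_range_succ,
    PowerSeries.coeff_pow_eq_zero_of_lt hg (Nat.lt_succ_self n), PowerSeries.coeff_C]
  simp [PowerSeries.coeff_one, add_comm]

/-- The words are sorted by the position of their first letter `f`. -/
theorem add_pow_succ_eq_sum {B : Type*} [Ring B] (a f : B) (n : ℕ) :
    (a + f) ^ (n + 1) = a ^ (n + 1) +
      ∑ x ∈ Finset.HasAntidiagonal.antidiagonal n, a ^ x.1 * f * (a + f) ^ x.2 := by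
  induction n with
  | zero => simp
  | succ n ih =>
    rw [Finset.Nat.sum_antidiagonal_succ, pow_succ' (a + f) (n + 1), add_mul]
    nth_rewrite 1 [ih]
    simp only [mul_add, Finset.mul_sum, pow_succ', mul_assoc, pow_zero, one_mul]
    abel

/-- A given total of the first and last exponents arises in one way more than its value. This
multiplicity is what produces the derivative of the Cauchy transform. -/
theorem sum_antidiagonal_fst_add {M : Type*} [AddCommMonoid M] (F : ℕ → ℕ → M) (n : ℕ) :
    ∑ x ∈ Finset.HasAntidiagonal.antidiagonal n, ∑ y ∈ Finset.HasAntidiagonal.antidiagonal x.2,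
        F (x.1 + y.1) y.2 =
      ∑ x ∈ Finset.HasAntidiagonal.antidiagonal n, (x.1 + 1) • F x.1 x.2 := by
  have h : ∀ x ∈ Finset.HasAntidiagonal.antidiagonal n, (x.1 + 1) • F x.1 x.2 =
      ∑ _y ∈ Finset.HasAntidiagonal.antidiagonal x.1, F x.1 x.2 := by
    intro x _
    rw [Finset.sum_const, Finset.Nat.card_antidiagonal]
  rw [Finset.sum_congr rfl h]
  simp only [Finset.sum_sigma']
  refine Finset.sum_nbij' (fun x => ⟨(x.1.1 + x.2.1, x.2.2), (x.1.1, x.2.1)⟩)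
    (fun x => ⟨(x.2.1, x.2.2 + x.1.2), (x.2.2, x.1.2)⟩) ?_ ?_ ?_ ?_ ?_
  · rintro ⟨⟨i, j⟩, ⟨k, l⟩⟩ h
    simp only [Finset.mem_sigma, Finset.HasAntidiagonal.mem_antidiagonal] at h ⊢
    simp only [and_true]
    lia
  · rintro ⟨⟨i, j⟩, ⟨k, l⟩⟩ h
    simp only [Finset.mem_sigma, Finset.HasAntidiagonal.mem_antidiagonal] at h ⊢
    simp only [and_true]
    lia
  · rintro ⟨⟨i, j⟩, ⟨k, l⟩⟩ h
    simp only [Finset.mem_sigma, Finset.HasAntidiagonal.mem_antidiagonal] at h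
    obtain ⟨-, rfl⟩ := h
    rfl
  · rintro ⟨⟨i, j⟩, ⟨k, l⟩⟩ h
    simp only [Finset.mem_sigma, Finset.HasAntidiagonal.mem_antidiagonal] at h
    obtain ⟨-, rfl⟩ := h
    rfl
  · rintro ⟨⟨i, j⟩, ⟨k, l⟩⟩ _
    rfl

/-- The list `l` records the gaps already closed, and `p` waits for the last exponent. Splitting the
remaining power at its next `f` mirrors the recursion `compSeries_eq`. -/
theorem apply_word_mul_add_pow {B : Type*} [Ring B] [Algebra ℂ B] {ψ : B →ₗ[ℂ] ℂ} {a f : B}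
    {m v : ℕ → ℂ}
    (hw : ∀ (p q : ℕ) (l : List ℕ), ψ (a ^ p * (l.map fun i => f * a ^ i).prod * f * a ^ q) =
      m (p + q) * (l.map m).prod * v (l.length + 1)) (n p : ℕ) (l : List ℕ) :
    ψ (a ^ p * (l.map fun i => f * a ^ i).prod * f * (a + f) ^ n) =
      (l.map m).prod * PowerSeries.coeff n ((PowerSeries.mk fun q => m (p + q)) *
        compSeries (fun k => v (l.length + 1 + k)) (PowerSeries.X * PowerSeries.mk m)) := by
  induction n using Nat.strong_induction_on generalizing l with
  | _ n ih =>
    rw [compSeries_eq _ (by simp)]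
    rcases n with _ | n
    · rw [pow_zero, ← pow_zero a, hw]
      simp
      ring
    · rw [add_pow_succ_eq_sum, mul_add, map_add, hw, mul_add, map_add, mul_add, PowerSeries.coeff_mul_C,
        PowerSeries.coeff_mk, mul_assoc PowerSeries.X, mul_left_comm _ PowerSeries.X,
        PowerSeries.coeff_succ_X_mul, mul_left_comm _ (PowerSeries.mk m), PowerSeries.coeff_mul,
        Finset.mul_sum, Finset.mul_sum, map_sum]
      congr 1
      · simp; ring
      · refine Finset.sum_congr rfl fun x hx => ?_
        have hx' := Finset.HasAntidiagonal.mem_antidiagonal.1 hx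
        -- The run `a ^ x.1` before the next `f` becomes an interior gap.
        have := ih x.2 (by omega) (l ++ [x.1])
        simp only [List.map_append, List.map_cons, List.map_nil, List.prod_append, List.prod_cons,
          List.prod_nil, mul_one, List.length_append, List.length_cons, List.length_nil,
          zero_add] at this
        rw [PowerSeries.coeff_mk, ← mul_assoc, ← mul_assoc] 
        simp only [mul_assoc, add_comm, add_left_comm] at this ⊢
        rw [this]

theorem apply_add_pow_succ {B : Type*} [Ring B] [Algebra ℂ B] {ψ : B →ₗ[ℂ] ℂ} {a f : B}
    {m v : ℕ → ℂ} (ha : ∀ n, ψ (a ^ n) = 0)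
    (hw : ∀ (p q : ℕ) (l : List ℕ), ψ (a ^ p * (l.map fun i => f * a ^ i).prod * f * a ^ q) =
      m (p + q) * (l.map m).prod * v (l.length + 1)) (n : ℕ) :
    ψ ((a + f) ^ (n + 1)) =
      PowerSeries.coeff n (PowerSeries.derivative ℂ (PowerSeries.X * PowerSeries.mk m) *
        compSeries (fun k => v (k + 1)) (PowerSeries.X * PowerSeries.mk m)) := by
  rw [add_pow_succ_eq_sum, map_add, ha, zero_add, map_sum, PowerSeries.coeff_mul]
  have h : ∀ p n, ψ (a ^ p * f * (a + f) ^ n) = PowerSeries.coeff n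
      ((PowerSeries.mk fun q => m (p + q)) * compSeries (fun k => v (k + 1))
        (PowerSeries.X * PowerSeries.mk m)) := by
    intro p n
    have := apply_word_mul_add_pow hw n p []
    simpa [add_comm] using this
  simp only [h, PowerSeries.coeff_mul, PowerSeries.coeff_mk]
  rw [sum_antidiagonal_fst_add (fun i j => m i * PowerSeries.coeff j (compSeries
    (fun k => v (k + 1)) (PowerSeries.X * PowerSeries.mk m)))]
  refine Finset.sum_congr rfl fun x _ => ?_
  rw [PowerSeries.coeff_derivative, PowerSeries.coeff_succ_X_mul, PowerSeries.coeff_mk,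
    nsmul_eq_mul]
  push_cast
  ring

/-- If `ψ` takes on words in `a` and `f` the values prescribed by cyclic-antimonotone independence,
then the distribution of `a + f` is determined by its Cauchy transform. -/
theorem cauchyTransform_distributionOf_add {B : Type*} [Ring B] [Algebra ℂ B] {ψ : B →ₗ[ℂ] ℂ}
    {a f : B} {μ ν : NCDistribution} (ha : ∀ n, ψ (a ^ n) = 0)
    (hw : ∀ (p q : ℕ) (l : List ℕ), ψ (a ^ p * (l.map fun i => f * a ^ i).prod * f * a ^ q) =
      μ (X ^ (p + q)) * (l.map fun i => μ (X ^ i)).prod * ν (X ^ (l.length + 1))) :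
    cauchyTransform (distributionOf ψ (a + f)) =
      HahnSeries.ofPowerSeries ℤ ℂ (cyclicConvSeries μ ν) := by
  rw [cauchyTransform]
  congr 1
  have hd : ∀ n, distributionOf ψ (a + f) (X ^ n) = ψ ((a + f) ^ n) := by
    intro n; simp [distributionOf]
  ext n
  rcases n with _ | _ | n
  · rw [coeff_zero_cauchySeries, cyclicConvSeries, PowerSeries.coeff_X_pow_mul', if_neg (by simp)]
  · rw [coeff_succ_cauchySeries, cyclicConvSeries, PowerSeries.coeff_X_pow_mul', if_neg (by simp),
      hd, pow_zero, ← pow_zero a, ha]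
  · rw [coeff_succ_cauchySeries, cyclicConvSeries, add_assoc n 1 1, PowerSeries.coeff_X_pow_mul,
      hd, apply_add_pow_succ (m := fun n => μ (X ^ n)) (v := fun n => ν (X ^ n)) ha hw]
    rfl

/-! ### Words in infinitesimally free elements, one of distribution `δ₀` -/

theorem Fin.eq_one_of_ne_zero_two {i : Fin 2} (h : i ≠ 0) : i = 1 := by omega

/-- The index of the letter `j` of an alternating word whose first letter has the index `s`. -/
def altIndex (s : Fin 2) : ℕ → Fin 2
  | 0 => s
  | j + 1 => altIndex (s + 1) j

theorem altIndex_ne (s : Fin 2) {j k : ℕ} (h : j + 1 = k) : altIndex s j ≠ altIndex s k := by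
  subst h
  induction j generalizing s with
  | zero => exact (by decide : ∀ s : Fin 2, s ≠ s + 1) s
  | succ j ih => exact ih (s + 1)

theorem exists_aeval_of_mem_adjoin_singleton {B : Type*} [Ring B] [Algebra ℂ B] {b x : B}
    (hx : x ∈ Algebra.adjoin ℂ {b}) : ∃ p : ℂ[X], aeval b p = x := by
  rwa [Algebra.adjoin_singleton_eq_range_aeval] at hx

theorem distributionOf_apply {B : Type*} [Ring B] [Algebra ℂ B] (ψ : B →ₗ[ℂ] ℂ) (b : B)
    (p : ℂ[X]) : distributionOf ψ b p = ψ (aeval b p) := rfl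

theorem distributionOf_X_pow {B : Type*} [Ring B] [Algebra ℂ B] (ψ : B →ₗ[ℂ] ℂ) (b : B)
    (n : ℕ) : distributionOf ψ b (X ^ n) = ψ (b ^ n) := by
  simp [distributionOf_apply]

namespace InfNCPS

variable {S : InfNCPS}

/-- `δ₀` is a character of `ℂ[x]`. Hence `φ` kills products of two centered elements of this
algebra. -/
theorem map_mul_of_distribution_eq_deltaZero {b : S.B} (hb : distributionOf S.φ b = deltaZero)
    {x y : S.B} (hx : x ∈ Algebra.adjoin ℂ {b}) (hy : y ∈ Algebra.adjoin ℂ {b}) :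
    S.φ (x * y) = S.φ x * S.φ y := by
  obtain ⟨p, rfl⟩ := exists_aeval_of_mem_adjoin_singleton hx
  obtain ⟨q, rfl⟩ := exists_aeval_of_mem_adjoin_singleton hy
  rw [← map_mul, ← distributionOf_apply, ← distributionOf_apply, ← distributionOf_apply, hb]
  simp [deltaZero]

theorem φ_centered (x : S.B) : S.φ (x - S.φ x • 1) = 0 := by
  rw [map_sub, map_smul, S.φ_one]; simp

/-- In an alternating palindromic word in two algebras that starts with the second algebra or has
at least four letters, some letter of the second algebra is paired with another one. -/
theorem prod_paired_eq_zero {B : Type*} [Mul B] {φ : B → ℂ} {n : ℕ} {i : Fin n → Fin 2}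
    {b : Fin n → B}
    (halt : ∀ j k : Fin n, (j : ℕ) + 1 = k → i j ≠ i k)
    (h1 : ∀ j k, i j = 1 → i k = 1 → φ (b j * b k) = 0)
    (hrev : ∀ j, i j = i j.rev) (hn : 4 ≤ n ∨ ∃ h : 2 ≤ n, i ⟨0, by omega⟩ = 1) :
    ∏ j ∈ Finset.univ.filter (fun j : Fin n => (j : ℕ) < n / 2), φ (b j * b j.rev) = 0 := by
  obtain ⟨j, hj, hij⟩ : ∃ j : Fin n, (j : ℕ) < n / 2 ∧ i j = 1 := by
    -- For `4 ≤ n` the first two letters both lie in the first half, and by alternation one of them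
    -- belongs to the second algebra.
    rcases hn with h | ⟨h, h'⟩
    · by_cases h0 : i ⟨0, by omega⟩ = 0
      · refine ⟨⟨1, by omega⟩, by simp; omega, Fin.eq_one_of_ne_zero_two fun h1 => ?_⟩
        exact halt ⟨0, by omega⟩ ⟨1, by omega⟩ rfl (h0.trans h1.symm)
      · exact ⟨⟨0, by omega⟩, by simp; omega, Fin.eq_one_of_ne_zero_two h0⟩
    · exact ⟨⟨0, by omega⟩, by simp; omega, h'⟩
  refine Finset.prod_eq_zero (i := j) (by simpa using hj) (h1 _ _ hij ?_)
  rw [← hrev, hij]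

/-- Words in centered elements that belong alternately to the algebras `C 0` and `C 1`, the first
letter belonging to `C s`. -/
inductive AltCentered (S : InfNCPS) (C : Fin 2 → Subalgebra ℂ S.B) : Fin 2 → List S.B → Prop
  | nil (s : Fin 2) : AltCentered S C s []
  | cons {s : Fin 2} {x : S.B} {w : List S.B} (hx : x ∈ C s) (h0 : S.φ x = 0)
      (hw : AltCentered S C (s + 1) w) : AltCentered S C s (x :: w)

variable {C : Fin 2 → Subalgebra ℂ S.B}

theorem AltCentered.get {s : Fin 2} {w : List S.B} (hw : S.AltCentered C s w) (j : Fin w.length) :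
    w.get j ∈ C (altIndex s j) ∧ S.φ (w.get j) = 0 := by
  induction hw with
  | nil => exact j.elim0
  | @cons s x w hx h0 _ ih =>
    refine Fin.cases ?_ (fun j => ?_) j
    · exact ⟨hx, h0⟩
    · exact ih j

theorem AltCentered.φ'_prod_of_even (hC : S.InfFree C) {s : Fin 2} {w : List S.B}
    (hw : S.AltCentered C s w) (hn : Even w.length) : S.φ' w.prod = 0 := by
  rcases w.eq_nil_or_concat with rfl | ⟨w', x, rfl⟩
  · simpa using S.φ'_one
  · have := (hC _ (by simp) (fun j => altIndex s j) _
      (fun j k h => altIndex_ne s h) (fun j => (hw.get j).1) (fun j => (hw.get j).2)).2.2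
        (fun h => Nat.not_odd_iff_even.2 hn h.1)
    rwa [List.ofFn_get] at this

/-- If the indices are not palindromic, freeness gives zero. Otherwise two letters of `C 1` are
paired, and `φ` of their product vanishes. -/
theorem AltCentered.φ'_prod_of_le (hC : S.InfFree C)
    (h1 : ∀ x ∈ C 1, ∀ y ∈ C 1, S.φ (x * y) = S.φ x * S.φ y) {s : Fin 2} {w : List S.B}
    (hw : S.AltCentered C s w) (hn : 4 ≤ w.length ∨ 2 ≤ w.length ∧ s = 1) : S.φ' w.prod = 0 := by
  have h0 : 0 < w.length := by omega
  have key := (hC _ h0 (fun j => altIndex s j) _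
    (fun j k h => altIndex_ne s h) (fun j => (hw.get j).1) (fun j => (hw.get j).2)).2
  rw [List.ofFn_get] at key
  by_cases h : Odd w.length ∧ ∀ j : Fin w.length,
      altIndex s j = altIndex s j.rev
  · rw [key.1 h, prod_paired_eq_zero (fun j k h => altIndex_ne s h) ?_ h.2 ?_, zero_mul]
    · intro j k hj hk
      rw [h1 _ (hj ▸ (hw.get j).1) _ (hk ▸ (hw.get k).1), (hw.get j).2, zero_mul]
    · exact hn.imp_right fun h => ⟨h.1, h.2⟩
  · exact key.2 h

theorem InfFree.φ'_mul_mul (hC : S.InfFree C) {x g y : S.B} (hx : x ∈ C 0) (hg : g ∈ C 1)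
    (hy : y ∈ C 0) (hx0 : S.φ x = 0) (hg0 : S.φ g = 0) (hy0 : S.φ y = 0) :
    S.φ' (x * g * y) = S.φ (x * y) * S.φ' g := by
  have := (hC 3 (by norm_num) ![0, 1, 0] ![x, g, y] (by decide)
    (by intro j; fin_cases j <;> assumption) (by intro j; fin_cases j <;> assumption)).2.1
    ⟨by decide, by decide⟩
  have hf : Finset.univ.filter (fun j : Fin 3 => (j : ℕ) < 3 / 2) = {0} := by decide
  rw [hf, Finset.prod_singleton] at this
  simpa [List.ofFn_succ, mul_assoc] using this

theorem AltCentered.blocks_append {f : S.B} (hf : ∀ k : ℕ, f ^ (k + 1) ∈ C 1)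
    (hf0 : ∀ k : ℕ, S.φ (f ^ (k + 1)) = 0) {L : List (ℕ × S.B)}
    (hL : ∀ b ∈ L, b.2 ∈ C 0 ∧ S.φ b.2 = 0) {t : List S.B} (ht : S.AltCentered C 1 t) :
    S.AltCentered C 1 ((L.flatMap fun b => [f ^ (b.1 + 1), b.2]) ++ t) := by
  induction L with
  | nil => simpa
  | cons b L ih =>
    have hb := hL b (by simp)
    exact .cons (hf _) (hf0 _) (.cons hb.1 hb.2 (ih fun b hb => hL b (by simp [hb])))

/-- `L` holds the finished blocks (a power of `f`, then a centered letter), `k + 1` is the length of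
the current run of `f`, and `zs` are the letters not yet centered. Any finished block forces zero,
so only the terms in which every interior letter became a scalar survive. -/
theorem InfFree.φ'_block_word (hC : S.InfFree C)
    (h1 : ∀ x ∈ C 1, ∀ y ∈ C 1, S.φ (x * y) = S.φ x * S.φ y) {f : S.B}
    (hf : ∀ k : ℕ, f ^ (k + 1) ∈ C 1) (hf0 : ∀ k : ℕ, S.φ (f ^ (k + 1)) = 0) {x y : S.B}
    (hx : x ∈ C 0) (hy : y ∈ C 0) (zs : List S.B) (hz : ∀ z ∈ zs, z ∈ C 0) (k : ℕ)
    (L : List (ℕ × S.B)) (hL : ∀ b ∈ L, b.2 ∈ C 0 ∧ S.φ b.2 = 0) :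
    S.φ' (x * (L.flatMap fun b => [f ^ (b.1 + 1), b.2]).prod * f ^ (k + 1) *
        (zs.map fun z => z * f).prod * y) =
      if L = [] then S.φ (x * y) * (zs.map S.φ).prod * S.φ' (f ^ (k + 1 + zs.length)) else 0 := by
  induction zs generalizing k L with
  | nil =>
    set g := (L.flatMap fun b => [f ^ (b.1 + 1), b.2]).prod * f ^ (k + 1) with hg
    set x₀ := x - S.φ x • 1 with hx₀
    set y₀ := y - S.φ y • 1 with hy₀
    have hx₀C : x₀ ∈ C 0 := sub_mem hx ((C 0).smul_mem (one_mem _) _)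
    have hy₀C : y₀ ∈ C 0 := sub_mem hy ((C 0).smul_mem (one_mem _) _)
    have hx₀0 : S.φ x₀ = 0 := φ_centered x
    have hy₀0 : S.φ y₀ = 0 := φ_centered y
    have hlen : (L.flatMap fun b => [f ^ (b.1 + 1), b.2]).length = 2 * L.length := by
      simp [List.length_flatMap, mul_comm]
    have hw : S.AltCentered C 1 ((L.flatMap fun b => [f ^ (b.1 + 1), b.2]) ++ [f ^ (k + 1)]) :=
      .blocks_append hf hf0 hL (.cons (hf k) (hf0 k) (.nil _))
    have hwy : S.AltCentered C 1
        ((L.flatMap fun b => [f ^ (b.1 + 1), b.2]) ++ [f ^ (k + 1), y₀]) :=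
      .blocks_append hf hf0 hL (.cons (hf k) (hf0 k) (.cons hy₀C hy₀0 (.nil _)))
    -- After centering `x` and `y`, the two mixed terms are alternating centered words of even
    -- length.
    have exg : S.φ' (x₀ * g) = 0 := by
      have := AltCentered.φ'_prod_of_even hC (.cons (s := 0) hx₀C hx₀0 hw)
        (by simp [hlen, parity_simps])
      simpa [hg, mul_assoc] using this
    have egy : S.φ' (g * y₀) = 0 := by
      have := AltCentered.φ'_prod_of_even hC hwy (by simp [hlen, parity_simps])
      simpa [hg, mul_assoc] using this
    have hx' : x = x₀ + S.φ x • 1 := by simp [hx₀]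
    have hy' : y = y₀ + S.φ y • 1 := by simp [hy₀]
    have hexp : S.φ' (x * g * y) = S.φ' (x₀ * g * y₀) + S.φ x * S.φ y * S.φ' g := by
      conv_lhs => rw [hx', hy']
      simp only [add_mul, mul_add, smul_mul_assoc, mul_smul_comm, one_mul, mul_one, map_add,
        map_smul, exg, egy, smul_eq_mul]
      ring
    have hlhs : x * (L.flatMap fun b => [f ^ (b.1 + 1), b.2]).prod * f ^ (k + 1) *
        (([] : List S.B).map fun z => z * f).prod * y = x * g * y := by
      simp [hg, mul_assoc]
    rw [hlhs, hexp]
    -- With no block, `φ(x₀ y₀) + φ(x) φ(y) = φ(x y)`. With a block, `g` has at least three letters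
    -- and starts in `C 1`, and `x₀ g y₀` has at least five, so both vanish.
    split_ifs with h
    · have hgf : g = f ^ (k + 1) := by simp [hg, h]
      have hxy : S.φ (x₀ * y₀) = S.φ (x * y) - S.φ x * S.φ y := by
        simp only [hx₀, hy₀, sub_mul, mul_sub, smul_mul_assoc, mul_smul_comm, one_mul, mul_one,
          map_sub, map_smul, S.φ_one, smul_eq_mul]
        ring
      rw [hgf, hC.φ'_mul_mul hx₀C (hf k) hy₀C hx₀0 (hf0 k) hy₀0, hxy]
      simp
      ring
    · have hL1 : 1 ≤ L.length := List.length_pos_iff.2 h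
      have e1 : S.φ' g = 0 := by
        have := hw.φ'_prod_of_le hC h1 (Or.inr ⟨by simp [hlen]; omega, rfl⟩)
        simpa [hg, mul_assoc] using this
      have e2 : S.φ' (x₀ * g * y₀) = 0 := by
        have := AltCentered.φ'_prod_of_le hC h1 (.cons (s := 0) hx₀C hx₀0 hwy)
          (Or.inl (by simp [hlen]; omega))
        simpa [hg, mul_assoc] using this
      rw [e1, e2]
      simp
  | cons z zs ih =>
    have hzs : ∀ z ∈ zs, z ∈ C 0 := fun z hz' => hz z (by simp [hz'])
    have hz0 : z ∈ C 0 := hz z (by simp)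
    set z₀ := z - S.φ z • 1 with hz₀
    have hz' : z = z₀ + S.φ z • 1 := by simp [hz₀]
    -- The centered part of `z` closes a block and starts a new run. The scalar part, treated by
    -- `i2`, lengthens the current run by one.
    have i1 := ih hzs 0 (L ++ [(k, z₀)]) (by
      intro b hb
      rcases List.mem_append.1 hb with hb | hb
      · exact hL b hb
      · obtain rfl := List.mem_singleton.1 hb
        exact ⟨sub_mem hz0 ((C 0).smul_mem (one_mem _) _), φ_centered z⟩)
    have i2 := ih hzs (k + 1) L hL
    rw [if_neg (by simp)] at i1
    have hsplit : x * (L.flatMap fun b => [f ^ (b.1 + 1), b.2]).prod * f ^ (k + 1) *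
          ((z :: zs).map fun z => z * f).prod * y =
        x * ((L ++ [(k, z₀)]).flatMap fun b => [f ^ (b.1 + 1), b.2]).prod * f ^ (0 + 1) *
          (zs.map fun z => z * f).prod * y +
        S.φ z • (x * (L.flatMap fun b => [f ^ (b.1 + 1), b.2]).prod * f ^ (k + 1 + 1) *
          (zs.map fun z => z * f).prod * y) := by
      rw [List.map_cons, List.prod_cons]
      conv_lhs => rw [hz']
      simp only [List.flatMap_append, List.prod_append, List.flatMap_cons, List.flatMap_nil,
        List.append_nil, List.prod_cons, List.prod_nil, mul_one, zero_add, pow_one, add_mul,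
        mul_add, smul_mul_assoc, mul_smul_comm, one_mul, pow_succ f (k + 1), mul_assoc]
    rw [hsplit, map_add, map_smul, i1, i2, zero_add]
    split_ifs
    · rw [List.map_cons, List.prod_cons, List.length_cons, smul_eq_mul, add_right_comm (k + 1) 1,
        add_assoc (k + 1)]
      ring
    · simp

theorem ElemInfFree.φ'_word {a f : S.B} (h : S.ElemInfFree a f)
    (hf : distributionOf S.φ f = deltaZero) (p q : ℕ) (l : List ℕ) :
    S.φ' (a ^ p * (l.map fun i => f * a ^ i).prod * f * a ^ q) =
      S.φ (a ^ (p + q)) * (l.map fun i => S.φ (a ^ i)).prod * S.φ' (f ^ (l.length + 1)) := by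
  have hfk : ∀ k : ℕ, f ^ (k + 1) ∈ Algebra.adjoin ℂ {f} := fun k =>
    pow_mem (Algebra.self_mem_adjoin_singleton ℂ f) _
  have hak : ∀ k : ℕ, a ^ k ∈ Algebra.adjoin ℂ {a} := fun k =>
    pow_mem (Algebra.self_mem_adjoin_singleton ℂ a) _
  have := InfFree.φ'_block_word h
    (fun x hx y hy => map_mul_of_distribution_eq_deltaZero hf hx hy) (f := f) hfk
    (fun k => by rw [← distributionOf_X_pow, hf]; simp [deltaZero]) (hak p) (hak q)
    (l.map fun i => a ^ i) (by simpa using fun i _ => hak i) 0 [] (by simp)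
  -- The first `f` is split off, so that it serves as the initial run in the block lemma.
  have hcomm : ∀ l : List ℕ, (l.map fun i => f * a ^ i).prod * f =
      f * (l.map fun i => a ^ i * f).prod := by
    intro l
    induction l with
    | nil => simp
    | cons i l ih => simp only [List.map_cons, List.prod_cons, mul_assoc, ih]
  rw [mul_assoc (a ^ p), hcomm]
  simpa [mul_assoc, pow_add, Function.comp_def, add_comm] using this

/-- The Cauchy transform of the distribution with respect to `φ'` of the sum of two infinitesimally
free elements of infinitesimal distributions `(μ, 0)` and `(δ₀, ν)`. -/
theorem ElemInfFree.cauchyTransform_add {a f : S.B} (h : S.ElemInfFree a f) {μ ν : NCDistribution}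
    (ha : S.infDistribution a = (μ, 0)) (hf : S.infDistribution f = (deltaZero, ν)) :
    cauchyTransform (distributionOf S.φ' (a + f)) =
      HahnSeries.ofPowerSeries ℤ ℂ (cyclicConvSeries μ ν) := by
  obtain ⟨rfl, ha'⟩ := Prod.mk.inj ha
  obtain ⟨hf0, rfl⟩ := Prod.mk.inj hf
  refine cauchyTransform_distributionOf_add (fun n => ?_) fun p q l => ?_
  · rw [← distributionOf_X_pow, ha', LinearMap.zero_apply]
  · simp only [distributionOf_X_pow]
    exact h.φ'_word hf0 p q l

end InfNCPS

/-! ### Cyclic-antimonotone independence implies infinitesimal freeness -/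

namespace TypeBPrimeNCPS

variable {S : TypeBPrimeNCPS}

theorem ofA_mul_ofA (a b : S.A) : S.ofA a * S.ofA b = S.ofA (a * b) :=
  alg_ext rfl (by simp [mul_snd, ofA_snd])

theorem ofA_mul_ofF (a : S.A) (f : S.F) : S.ofA a * S.ofF f = S.ofF (a • f) :=
  alg_ext (by simp [mul_fst, ofF_fst])
    (by simp [mul_snd, ofA_fst, ofA_snd, ofF_fst, ofF_snd])

theorem ofF_mul_ofA (f : S.F) (a : S.A) : S.ofF f * S.ofA a = S.ofF (MulOpposite.op a • f) :=
  alg_ext (by simp [mul_fst, ofF_fst])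
    (by simp [mul_snd, ofA_fst, ofA_snd, ofF_fst, ofF_snd])

theorem ofF_mul_ofF (f g : S.F) : S.ofF f * S.ofF g = S.ofF (f * g) :=
  alg_ext (by simp [mul_fst, ofF_fst]) (by simp [mul_snd, ofF_fst, ofF_snd])

theorem ofA_one : S.ofA 1 = 1 := rfl

theorem ofF_add (f g : S.F) : S.ofF (f + g) = S.ofF f + S.ofF g :=
  alg_ext (by simp [add_fst, ofF_fst]) rfl

theorem ofF_smul (c : ℂ) (f : S.F) : S.ofF (c • f) = c • S.ofF f :=
  alg_ext (by simp [smul_fst, ofF_fst]) rfl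

theorem ofF_zero : S.ofF 0 = 0 := rfl

/-- The embedding of `A` into `A⟨F⟩`, as an algebra homomorphism. -/
def ofAHom (S : TypeBPrimeNCPS) : S.A →ₐ[ℂ] S.Alg :=
  AlgHom.ofLinearMap
    { toFun := S.ofA
      map_add' := fun _ _ => alg_ext rfl (by simp [add_snd, ofA_snd])
      map_smul' := fun _ _ => alg_ext rfl (by simp [smul_snd, ofA_snd]) }
    rfl fun a b => (ofA_mul_ofA a b).symm

/-- The projection of `A⟨F⟩` onto `A`. -/
def fstHom (S : TypeBPrimeNCPS) : S.Alg →ₐ[ℂ] S.A :=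
  AlgHom.ofLinearMap (LinearMap.fst ℂ S.A S.F) rfl fun _ _ => rfl

theorem fstHom_apply (x : S.Alg) : S.fstHom x = x.1 := rfl

/-- The functional `φ` on `A⟨F⟩`. -/
def trA (S : TypeBPrimeNCPS) : S.Alg →ₗ[ℂ] ℂ := S.φ ∘ₗ LinearMap.fst ℂ S.A S.F

/-- The functional `φ'` on `A⟨F⟩`. -/
def trF (S : TypeBPrimeNCPS) : S.Alg →ₗ[ℂ] ℂ := S.Φ ∘ₗ LinearMap.snd ℂ S.A S.F

theorem trA_apply (x : S.Alg) : S.trA x = S.φ x.1 := rfl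

theorem exists_ofA_of_mem_adjoin {a : S.A} {x : S.Alg} (hx : x ∈ Algebra.adjoin ℂ {S.ofA a}) :
    ∃ b ∈ Algebra.adjoin ℂ {a}, S.ofA b = x := by
  have h := AlgHom.map_adjoin_singleton S.ofAHom a
  change _ = Algebra.adjoin ℂ {S.ofA a} at h
  rw [← h] at hx
  exact hx

theorem exists_add_ofF_of_mem_adjoin {f : S.F} {x : S.Alg}
    (hx : x ∈ Algebra.adjoin ℂ {S.ofF f}) :
    ∃ c : ℂ, ∃ g ∈ NonUnitalAlgebra.adjoin ℂ {f}, c • (1 : S.Alg) + S.ofF g = x := by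
  induction hx using Algebra.adjoin_induction with
  | mem x hx =>
    obtain rfl := Set.mem_singleton_iff.1 hx
    exact ⟨0, f, NonUnitalAlgebra.self_mem_adjoin_singleton ℂ f, by simp⟩
  | algebraMap r => exact ⟨r, 0, zero_mem _, by simp [ofF_zero, Algebra.algebraMap_eq_smul_one]⟩
  | add x y _ _ hx hy =>
    obtain ⟨c, g, hg, rfl⟩ := hx
    obtain ⟨d, h, hh, rfl⟩ := hy
    exact ⟨c + d, g + h, add_mem hg hh, by rw [ofF_add, add_smul]; abel⟩
  | mul x y _ _ hx hy =>
    obtain ⟨c, g, hg, rfl⟩ := hx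
    obtain ⟨d, h, hh, rfl⟩ := hy
    refine ⟨c * d, c • h + d • g + g * h, add_mem (add_mem (SMulMemClass.smul_mem _ hh)
      (SMulMemClass.smul_mem _ hg)) (mul_mem hg hh), ?_⟩
    simp only [ofF_add, ofF_smul, ← ofF_mul_ofF, add_mul, mul_add, smul_mul_assoc, mul_smul_comm,
      one_mul, mul_one, smul_smul, smul_add, mul_comm d c]
    abel

/-- Here `φ` reads off the scalar part, so centering removes exactly the unit adjoined to the
algebra of `f`. -/
theorem exists_ofF_of_mem_adjoin {f : S.F} {x : S.Alg} (hx : x ∈ Algebra.adjoin ℂ {S.ofF f})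
    (h0 : S.trA x = 0) : ∃ g ∈ NonUnitalAlgebra.adjoin ℂ {f}, S.ofF g = x := by
  obtain ⟨c, g, hg, rfl⟩ := exists_add_ofF_of_mem_adjoin hx
  refine ⟨g, hg, ?_⟩
  have : c = 0 := by
    rw [trA_apply, add_fst, smul_fst, one_fst, ofF_fst, add_zero, map_smul, S.φ_one] at h0
    simpa using h0
  simp [this]

variable {A₁ : Subalgebra ℂ S.A} {F₁ : NonUnitalSubalgebra ℂ S.F}

theorem CyclicAntimonotone.φ'_mul_mul (h : S.CyclicAntimonotone A₁ F₁) {x y : S.A} {g : S.F}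
    (hx : x ∈ A₁) (hy : y ∈ A₁) (hg : g ∈ F₁) :
    S.trF (S.ofA x * (S.ofF g * S.ofA y)) = S.φ (x * y) * S.trF (S.ofF g) := by
  have : S.trF _ = _ * _ * S.trF _ := h 0 ![x, y] ![g] (by intro k; fin_cases k <;> assumption)
    (by intro k; fin_cases k; assumption)
  simpa [List.ofFn_succ] using this

/-- A product in which a centered element of `A` stands between two elements of `F` has trace
zero. -/
theorem CyclicAntimonotone.φ'_list (h : S.CyclicAntimonotone A₁ F₁) {x c : S.A} {g : S.F}
    (hx : x ∈ A₁) (hg : g ∈ F₁) (hc : c ∈ A₁) (hc0 : S.φ c = 0) (p : S.F × S.A)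
    (L : List (S.F × S.A)) (hL : ∀ q ∈ p :: L, q.1 ∈ F₁ ∧ q.2 ∈ A₁) :
    S.trF (S.ofA x * (S.ofF g * S.ofA c *
      ((p :: L).map fun q => S.ofF q.1 * S.ofA q.2).prod)) = 0 := by
  set K := (g, c) :: p :: L with hK
  have hKmem : ∀ q ∈ K, q.1 ∈ F₁ ∧ q.2 ∈ A₁ := by
    intro q hq
    rcases List.mem_cons.1 hq with rfl | hq
    · exact ⟨hg, hc⟩
    · exact hL q hq
  have : S.trF _ = _ * _ * S.trF _ := h (L.length + 1) (Fin.cons x fun k => (K.get k).2) (fun k => (K.get k).1)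
    (fun k => by
      refine Fin.cases hx (fun k => ?_) k
      exact (hKmem _ (List.get_mem _ _)).2)
    (fun k => (hKmem _ (List.get_mem _ _)).1)
  have hprod : (List.ofFn fun k : Fin (L.length + 1 + 1) => S.ofF (K.get k).1 *
      S.ofA ((Fin.cons x fun k => (K.get k).2 : Fin (L.length + 1 + 2) → S.A) k.succ)) =
      K.map fun q => S.ofF q.1 * S.ofA q.2 := by
    simp only [Fin.cons_succ]
    conv_rhs => rw [← List.ofFn_get K, List.map_ofFn]
    rfl
  -- The factor of index `0` is `φ(c)`, since `c` is the first interior element of `A`.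
  rw [hprod, Finset.prod_eq_zero (i := 0) (Finset.mem_univ _) hc0, mul_zero, zero_mul] at this
  simpa [hK, mul_assoc] using this

/-- Adjacent letters of `A` are merged and a `1` is inserted where none follows a letter of `F`,
which gives the tail the shape required by `CyclicAntimonotone`. -/
theorem exists_normal_form (w : List S.Alg)
    (hw : ∀ e ∈ w, (∃ b ∈ A₁, S.ofA b = e) ∨ ∃ g ∈ F₁, S.ofF g = e) {y : S.A} (hy : y ∈ A₁) :
    ∃ z ∈ A₁, ∃ L : List (S.F × S.A), (∀ q ∈ L, q.1 ∈ F₁ ∧ q.2 ∈ A₁) ∧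
      S.ofA y * w.prod = S.ofA z * (L.map fun q => S.ofF q.1 * S.ofA q.2).prod := by
  induction w generalizing y with
  | nil => exact ⟨y, hy, [], by simp, by simp⟩
  | cons e w ih =>
    have hw' : ∀ e ∈ w, (∃ b ∈ A₁, S.ofA b = e) ∨ ∃ g ∈ F₁, S.ofF g = e :=
      fun e he => hw e (by simp [he])
    rcases hw e (by simp) with ⟨b, hb, rfl⟩ | ⟨g, hg, rfl⟩
    · obtain ⟨z, hz, L, hL, h⟩ := ih hw' (mul_mem hy hb)
      exact ⟨z, hz, L, hL, by rw [List.prod_cons, ← mul_assoc, ofA_mul_ofA, h]⟩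
    · obtain ⟨z, hz, L, hL, h⟩ := ih hw' (one_mem A₁)
      rw [ofA_one, one_mul] at h
      refine ⟨y, hy, (g, z) :: L, ?_, by rw [List.prod_cons, h]; simp [mul_assoc]⟩
      intro q hq
      rcases List.mem_cons.1 hq with rfl | hq
      · exact ⟨hg, hz⟩
      · exact hL q hq

theorem CyclicAntimonotone.φ'_word_eq_zero (h : S.CyclicAntimonotone A₁ F₁) {x c : S.A} {g k : S.F}
    (hx : x ∈ A₁) (hg : g ∈ F₁) (hc : c ∈ A₁) (hc0 : S.φ c = 0) (hk : k ∈ F₁) (w : List S.Alg)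
    (hw : ∀ e ∈ w, (∃ b ∈ A₁, S.ofA b = e) ∨ ∃ g ∈ F₁, S.ofF g = e) :
    S.trF (S.ofA x * (S.ofF g * (S.ofA c * (S.ofF k * w.prod)))) = 0 := by
  obtain ⟨z, hz, L, hL, h'⟩ := exists_normal_form w hw (one_mem A₁)
  rw [ofA_one, one_mul] at h'
  have := h.φ'_list hx hg hc hc0 (k, z) L (by
    intro q hq
    rcases List.mem_cons.1 hq with rfl | hq
    · exact ⟨hk, hz⟩
    · exact hL q hq)
  rw [h']
  simpa [mul_assoc] using this

/-- A word with a letter in `F` projects to `0` in `A`, which settles `φ`. For `φ'`, a word of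
length at least four, or of length three starting in `F`, has a centered element of `A` between two
of `F` and vanishes, as does the paired product. The pattern `x g y` gives `φ(xy) Φ(g)`, and shorter
words are direct. -/
theorem ElemCyclicAntimonotone.alternating_word {a : S.A} {f : S.F}
    (h : S.ElemCyclicAntimonotone a f) (n : ℕ) (hn : 0 < n) (i : Fin n → Fin 2) (b : Fin n → S.Alg)
    (halt : ∀ j k : Fin n, (j : ℕ) + 1 = k → i j ≠ i k)
    (hb : ∀ j, b j ∈ (![Algebra.adjoin ℂ {S.ofA a}, Algebra.adjoin ℂ {S.ofF f}] :
      Fin 2 → Subalgebra ℂ S.Alg) (i j)) (hφ : ∀ j, S.trA (b j) = 0) :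
    S.trA (List.ofFn b).prod = 0 ∧
    ((Odd n ∧ ∀ j, i j = i j.rev) →
      S.trF (List.ofFn b).prod =
        (∏ j ∈ Finset.univ.filter (fun j : Fin n => (j : ℕ) < n / 2), S.trA (b j * b j.rev)) *
          S.trF (b ⟨n / 2, Nat.div_lt_self hn one_lt_two⟩)) ∧
    (¬(Odd n ∧ ∀ j, i j = i j.rev) → S.trF (List.ofFn b).prod = 0) := by
  have hA : ∀ j, i j = 0 → ∃ x ∈ Algebra.adjoin ℂ {a}, S.ofA x = b j ∧ S.φ x = 0 := by
    intro j hj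
    have hj' := hb j
    rw [hj] at hj'
    obtain ⟨x, hx, hxb⟩ := exists_ofA_of_mem_adjoin hj'
    have := hφ j
    rw [← hxb] at this
    exact ⟨x, hx, hxb, this⟩
  have hF : ∀ j, i j = 1 → ∃ g ∈ NonUnitalAlgebra.adjoin ℂ {f}, S.ofF g = b j := by
    intro j hj
    have hj' := hb j
    rw [hj] at hj'
    exact exists_ofF_of_mem_adjoin hj' (hφ j)
  have hAF : ∀ j, (∃ x ∈ Algebra.adjoin ℂ {a}, S.ofA x = b j) ∨
      ∃ g ∈ NonUnitalAlgebra.adjoin ℂ {f}, S.ofF g = b j := by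
    intro j
    by_cases hj : i j = 0
    · obtain ⟨x, hx, hxb, -⟩ := hA j hj
      exact Or.inl ⟨x, hx, hxb⟩
    · exact Or.inr (hF j (Fin.eq_one_of_ne_zero_two hj))
  have h1 : ∀ j k, i j = 1 → i k = 1 → S.trA (b j * b k) = 0 := by
    intro j k hj hk
    obtain ⟨g, -, hg⟩ := hF j hj
    obtain ⟨g', -, hg'⟩ := hF k hk
    rw [← hg, ← hg', ofF_mul_ofF, trA_apply, ofF_fst, map_zero]
  have h1A : (1 : S.A) ∈ Algebra.adjoin ℂ {a} := one_mem _
  obtain ⟨m, rfl⟩ : ∃ m, n = m + 1 := ⟨n - 1, by omega⟩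
  constructor
  · rcases m with _ | m
    · simpa [List.ofFn_succ] using hφ 0
    · obtain ⟨j, hj⟩ : ∃ j, i j = 1 := by
        by_cases h0 : i 0 = 0
        · exact ⟨1, Fin.eq_one_of_ne_zero_two fun h1 => halt 0 1 rfl (h0.trans h1.symm)⟩
        · exact ⟨0, Fin.eq_one_of_ne_zero_two h0⟩
      obtain ⟨g, -, hg⟩ := hF j hj
      rw [trA_apply, ← fstHom_apply]
      rw [map_list_prod, List.prod_eq_zero, map_zero]
      refine List.mem_map.2 ⟨b j, List.mem_ofFn.2 ⟨j, rfl⟩, ?_⟩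
      rw [← hg, fstHom_apply, ofF_fst]
  · have hne : ∀ j k : Fin (m + 1), (j : ℕ) + 1 = k → i j = 0 → i k = 1 := fun j k hjk hj =>
      Fin.eq_one_of_ne_zero_two fun hk => halt j k hjk (hj.trans hk.symm)
    have hne' : ∀ j k : Fin (m + 1), (j : ℕ) + 1 = k → i j = 1 → i k = 0 := fun j k hjk hj => by
      by_contra hk
      exact halt j k hjk (hj.trans (Fin.eq_one_of_ne_zero_two hk).symm)
    rcases m with _ | _ | m
    · refine ⟨fun _ => ?_, fun hpal => absurd ⟨odd_one, fun j => ?_⟩ hpal⟩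
      · simp [List.ofFn_succ]
      · exact congrArg i (by omega)
    · refine ⟨fun hpal => absurd hpal.1 (by decide), fun _ => ?_⟩
      by_cases h0 : i 0 = 0
      · obtain ⟨x, hx, hxb, hx0⟩ := hA 0 h0
        obtain ⟨g, hg, hgb⟩ := hF 1 (hne 0 1 rfl h0)
        have := h.φ'_mul_mul hx h1A hg
        rw [mul_one, hx0, zero_mul, ofA_one, mul_one, hxb, hgb] at this
        simpa [List.ofFn_succ] using this
      · have h0 := Fin.eq_one_of_ne_zero_two h0
        obtain ⟨x, hx, hxb, hx0⟩ := hA 1 (hne' 0 1 rfl h0)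
        obtain ⟨g, hg, hgb⟩ := hF 0 h0
        have := h.φ'_mul_mul h1A hx hg
        rw [one_mul, hx0, zero_mul, ofA_one, one_mul, hxb, hgb] at this
        simpa [List.ofFn_succ] using this
    · by_cases hfst : i 0 = 0
      · have h10 := hne 0 1 rfl hfst
        have h20 := hne' 1 2 rfl h10
        obtain ⟨x, hx, hxb, hx0⟩ := hA 0 hfst
        obtain ⟨g, hg, hgb⟩ := hF 1 h10
        obtain ⟨y, hy, hyb, hy0⟩ := hA 2 h20
        rcases m with _ | m
        · have hval := h.φ'_mul_mul hx hy hg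
          rw [hxb, hgb, hyb] at hval
          refine ⟨fun _ => ?_, fun hpal => absurd ⟨by decide, fun j => ?_⟩ hpal⟩
          · have hf : Finset.univ.filter (fun j : Fin 3 => (j : ℕ) < 3 / 2) = {0} := by decide
            have hφxy : S.φ (x * y) = S.trA (b 0 * b 2) := by
              rw [← hxb, ← hyb, ofA_mul_ofA]; rfl
            rw [hφxy] at hval
            simp only [zero_add, Nat.reduceAdd, hf, Finset.prod_singleton]
            simpa [List.ofFn_succ] using hval
          · fin_cases j
            · exact hfst.trans h20.symm
            · rfl
            · exact h20.trans hfst.symm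
        · obtain ⟨k, hk, hkb⟩ := hF (Fin.succ 2) (hne 2 (Fin.succ 2) rfl h20)
          have hzero : S.trF (List.ofFn b).prod = 0 := by
            have := h.φ'_word_eq_zero hx hg hy hy0 hk
              (List.ofFn fun j : Fin m => b j.succ.succ.succ.succ) (by
                intro e he
                obtain ⟨j, rfl⟩ := List.mem_ofFn.1 he
                exact hAF _)
            rw [hxb, hgb, hyb, hkb] at this
            simpa [List.ofFn_succ] using this
          refine ⟨fun hpal => ?_, fun _ => hzero⟩
          rw [InfNCPS.prod_paired_eq_zero (φ := S.trA) halt h1 hpal.2 (Or.inl (by omega)), hzero, zero_mul]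
      · have hfst := Fin.eq_one_of_ne_zero_two hfst
        have h10 := hne' 0 1 rfl hfst
        obtain ⟨g, hg, hgb⟩ := hF 0 hfst
        obtain ⟨y, hy, hyb, hy0⟩ := hA 1 h10
        obtain ⟨k, hk, hkb⟩ := hF 2 (hne 1 2 rfl h10)
        have hzero : S.trF (List.ofFn b).prod = 0 := by
          have := h.φ'_word_eq_zero h1A hg hy hy0 hk
            (List.ofFn fun j : Fin m => b j.succ.succ.succ) (by
              intro e he
              obtain ⟨j, rfl⟩ := List.mem_ofFn.1 he
              exact hAF _)
          rw [ofA_one, one_mul, hgb, hyb, hkb] at this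
          simpa [List.ofFn_succ] using this
        refine ⟨fun hpal => ?_, fun _ => hzero⟩
        rw [InfNCPS.prod_paired_eq_zero (φ := S.trA) halt h1 hpal.2 (Or.inr ⟨by omega, hfst⟩), hzero, zero_mul]

/-- Cyclic-antimonotone independent elements are infinitesimally free in `A⟨F⟩`. -/
theorem ElemCyclicAntimonotone.elemInfFree {a : S.A} {f : S.F} (h : S.ElemCyclicAntimonotone a f) :
    S.toInf.ElemInfFree (S.ofA a) (S.ofF f) :=
  h.alternating_word

/-- The projection of `A⟨F⟩` onto `A` is a homomorphism sending `a + f` to `a`. -/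
theorem distributionOf_φ_ofA_add (a : S.A) (f : S.F) :
    distributionOf S.trA (S.ofA a + S.ofF f) = distributionOf S.φ a := by
  refine LinearMap.ext fun p => ?_
  rw [distributionOf_apply, distributionOf_apply, trA_apply, ← fstHom_apply]
  rw [← Polynomial.aeval_algHom_apply, fstHom_apply, add_fst, ofA_fst, ofF_fst, add_zero]

theorem infDistribution_ofA (a : S.A) :
    S.toInf.infDistribution (S.ofA a) = (distributionOf S.φ a, 0) := by
  refine Prod.ext ?_ (LinearMap.ext fun p => ?_)
  · have := distributionOf_φ_ofA_add (S := S) a 0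
    rwa [ofF_zero, add_zero] at this
  · have : aeval (S.ofA a) p = S.ofA (aeval a p) := Polynomial.aeval_algHom_apply S.ofAHom a p
    change S.trF (aeval (S.ofA a) p) = 0
    rw [this]
    exact map_zero S.Φ

theorem infDistribution_ofF (f : S.F) :
    S.toInf.infDistribution (S.ofF f) = (deltaZero, distributionOf S.toInf.φ' (S.ofF f)) := by
  refine Prod.ext (NCDistribution.ext_moments fun n => ?_) rfl
  have := distributionOf_φ_ofA_add (S := S) 0 f
  have h0 : S.ofA 0 = 0 := rfl
  rw [h0, zero_add] at this
  change distributionOf S.trA (S.ofF f) (X ^ n) = _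
  rw [this, distributionOf_X_pow]
  rcases n with _ | n
  · simp [S.φ_one, deltaZero]
  · simp [deltaZero]

theorem ElemCyclicAntimonotone.cauchyTransform_add {a : S.A} {f : S.F}
    (h : S.ElemCyclicAntimonotone a f) :
    cauchyTransform (distributionOf S.toInf.φ' (S.ofA a + S.ofF f)) =
      HahnSeries.ofPowerSeries ℤ ℂ (cyclicConvSeries (distributionOf S.φ a)
        (distributionOf S.toInf.φ' (S.ofF f))) :=
  h.elemInfFree.cauchyTransform_add (infDistribution_ofA a) (infDistribution_ofF f)

end TypeBPrimeNCPS

/-! ### Existence: the sandwich model -/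

section

open scoped TensorProduct

/-- The vector space `ℂ[x] ⊗ ℂ[y] ⊗ ℂ[x]`, with the product
`(a ⊗ g ⊗ b) (c ⊗ h ⊗ d) = μ(b c) a ⊗ g h ⊗ d`. -/
def SandwichAlgebra (_μ : NCDistribution) : Type := ℂ[X] ⊗[ℂ] (ℂ[X] ⊗[ℂ] ℂ[X])

namespace SandwichAlgebra

variable {μ : NCDistribution}

noncomputable instance : AddCommGroup (SandwichAlgebra μ) :=
  inferInstanceAs (AddCommGroup (ℂ[X] ⊗[ℂ] (ℂ[X] ⊗[ℂ] ℂ[X])))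

noncomputable instance : Module ℂ (SandwichAlgebra μ) :=
  inferInstanceAs (Module ℂ (ℂ[X] ⊗[ℂ] (ℂ[X] ⊗[ℂ] ℂ[X])))

/-- The element `a ⊗ g ⊗ b`. -/
noncomputable def tmul (μ : NCDistribution) (a g b : ℂ[X]) : SandwichAlgebra μ :=
  a ⊗ₜ[ℂ] (g ⊗ₜ[ℂ] b)

@[elab_as_elim]
theorem induction {motive : SandwichAlgebra μ → Prop} (x : SandwichAlgebra μ) (zero : motive 0)
    (tmul : ∀ a g b, motive (tmul μ a g b))
    (add : ∀ x y, motive x → motive y → motive (x + y)) : motive x := by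
  refine TensorProduct.induction_on (motive := motive) x zero (fun a n => ?_) add
  refine TensorProduct.induction_on (motive := fun n => motive (a ⊗ₜ[ℂ] n)) n ?_ (tmul a) ?_
  · rw [TensorProduct.tmul_zero]
    exact zero
  · intro x y hx hy
    rw [TensorProduct.tmul_add]
    exact add _ _ hx hy

/-- The map `g ⊗ b ↦ (c ⊗ h ⊗ d ↦ μ(b c) g h ⊗ d)`. -/
noncomputable def contract (μ : NCDistribution) :
    ℂ[X] ⊗[ℂ] ℂ[X] →ₗ[ℂ] ℂ[X] ⊗[ℂ] (ℂ[X] ⊗[ℂ] ℂ[X]) →ₗ[ℂ] ℂ[X] ⊗[ℂ] ℂ[X] :=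
  TensorProduct.lift <| LinearMap.mk₂ ℂ
    (fun g b => (TensorProduct.lid ℂ (ℂ[X] ⊗[ℂ] ℂ[X])).toLinearMap ∘ₗ
      TensorProduct.map (μ ∘ₗ LinearMap.mulLeft ℂ b) (LinearMap.rTensor ℂ[X] (LinearMap.mulLeft ℂ g)))
    (fun g g' b => by ext; simp [add_mul, TensorProduct.add_tmul])
    (fun c g b => by
      ext
      simp [TensorProduct.smul_tmul']
      rw [smul_comm])
    (fun g b b' => by ext; simp [add_mul, add_smul])
    (fun c g b => by ext; simp [mul_smul])

/-- The map `a ⊗ n ↦ (x ↦ a ⊗ contract n x)`. -/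
noncomputable def tensorMulMap (μ : NCDistribution) :
    ℂ[X] ⊗[ℂ] (ℂ[X] ⊗[ℂ] ℂ[X]) →ₗ[ℂ] ℂ[X] ⊗[ℂ] (ℂ[X] ⊗[ℂ] ℂ[X]) →ₗ[ℂ]
      ℂ[X] ⊗[ℂ] (ℂ[X] ⊗[ℂ] ℂ[X]) :=
  TensorProduct.lift <| LinearMap.mk₂ ℂ
    (fun a n => (TensorProduct.mk ℂ ℂ[X] (ℂ[X] ⊗[ℂ] ℂ[X]) a) ∘ₗ contract μ n)
    (fun a a' n => by rw [map_add, LinearMap.add_comp])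
    (fun c a n => by rw [map_smul, LinearMap.smul_comp])
    (fun a n n' => by rw [map_add, LinearMap.comp_add])
    (fun c a n => by rw [map_smul, LinearMap.comp_smul])

/-- The product of the sandwich algebra. -/
noncomputable def mulMap (μ : NCDistribution) :
    SandwichAlgebra μ →ₗ[ℂ] SandwichAlgebra μ →ₗ[ℂ] SandwichAlgebra μ :=
  tensorMulMap μ

noncomputable instance : Mul (SandwichAlgebra μ) := ⟨fun x y => mulMap μ x y⟩

theorem mul_def (x y : SandwichAlgebra μ) : x * y = mulMap μ x y := rfl

theorem tmul_mul_tmul (a g b c h d : ℂ[X]) :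
    tmul μ a g b * tmul μ c h d = μ (b * c) • tmul μ a (g * h) d := by
  change a ⊗ₜ[ℂ] (μ (b * c) • ((g * h) ⊗ₜ[ℂ] d)) = _
  rw [TensorProduct.tmul_smul]
  rfl

noncomputable instance : NonUnitalNonAssocRing (SandwichAlgebra μ) :=
  { (inferInstance : AddCommGroup (SandwichAlgebra μ)),
    (inferInstance : Mul (SandwichAlgebra μ)) with
    left_distrib := fun x y z => map_add (mulMap μ x) y z
    right_distrib := fun x y z => by simp only [mul_def, map_add, LinearMap.add_apply]
    zero_mul := fun x => by simp only [mul_def, map_zero, LinearMap.zero_apply]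
    mul_zero := fun x => map_zero (mulMap μ x) }

instance : IsScalarTower ℂ (SandwichAlgebra μ) (SandwichAlgebra μ) :=
  ⟨fun c x y => by simp only [smul_eq_mul, mul_def, map_smul, LinearMap.smul_apply]⟩

instance : SMulCommClass ℂ (SandwichAlgebra μ) (SandwichAlgebra μ) :=
  ⟨fun c x y => by simp only [smul_eq_mul, mul_def, map_smul]⟩

noncomputable instance : NonUnitalRing (SandwichAlgebra μ) :=
  { (inferInstance : NonUnitalNonAssocRing (SandwichAlgebra μ)) with
    mul_assoc := fun x y z => by
      induction x using induction with
      | zero => simp only [zero_mul]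
      | add x x' hx hx' => simp only [add_mul, hx, hx']
      | tmul a g b =>
        induction y using induction with
        | zero => simp only [zero_mul, mul_zero]
        | add y y' hy hy' => simp only [add_mul, mul_add, hy, hy']
        | tmul a' g' b' =>
          induction z using induction with
          | zero => simp only [mul_zero]
          | add z z' hz hz' => simp only [mul_add, hz, hz']
          | tmul a'' g'' b'' =>
            -- Both bracketings contract the same two pairs of legs, giving `μ(b a') μ(b' a'')`.
            simp only [tmul_mul_tmul, smul_mul_assoc, mul_smul_comm, mul_assoc, smul_smul]
            rw [mul_comm] }

/-- The multiplication of the left tensor factor. -/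
noncomputable def leftMul (μ : NCDistribution) : ℂ[X] →ₐ[ℂ] Module.End ℂ (SandwichAlgebra μ) :=
  (Algebra.lmul ℂ (ℂ[X] ⊗[ℂ] (ℂ[X] ⊗[ℂ] ℂ[X]))).comp Algebra.TensorProduct.includeLeft

/-- The multiplication of the right tensor factor. -/
noncomputable def rightMul (μ : NCDistribution) : ℂ[X] →ₐ[ℂ] Module.End ℂ (SandwichAlgebra μ) :=
  (Algebra.lmul ℂ (ℂ[X] ⊗[ℂ] (ℂ[X] ⊗[ℂ] ℂ[X]))).comp
    (Algebra.TensorProduct.includeRight.comp Algebra.TensorProduct.includeRight)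

noncomputable instance : Module ℂ[X] (SandwichAlgebra μ) :=
  Module.compHom _ (leftMul μ).toRingHom

/-- Commutativity of `ℂ[X]` identifies it with its opposite ring. -/
noncomputable instance : Module ℂ[X]ᵐᵒᵖ (SandwichAlgebra μ) :=
  Module.compHom _ ((rightMul μ).toRingHom.comp (RingEquiv.toOpposite ℂ[X]).symm.toRingHom)

theorem smul_def (p : ℂ[X]) (x : SandwichAlgebra μ) : p • x = leftMul μ p x := rfl

theorem op_smul_def (p : ℂ[X]) (x : SandwichAlgebra μ) :
    MulOpposite.op p • x = rightMul μ p x := rfl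

theorem smul_tmul (p a g b : ℂ[X]) : p • tmul μ a g b = tmul μ (p * a) g b := by
  change (p ⊗ₜ[ℂ] (1 ⊗ₜ[ℂ] 1)) * (a ⊗ₜ[ℂ] (g ⊗ₜ[ℂ] b)) = _
  simp [tmul]

theorem op_smul_tmul (p a g b : ℂ[X]) : MulOpposite.op p • tmul μ a g b = tmul μ a g (b * p) := by
  change (1 ⊗ₜ[ℂ] (1 ⊗ₜ[ℂ] p)) * (a ⊗ₜ[ℂ] (g ⊗ₜ[ℂ] b)) = _
  simp [tmul, mul_comm]

instance : IsScalarTower ℂ ℂ[X] (SandwichAlgebra μ) :=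
  ⟨fun c p x => by simp only [smul_def, map_smul, LinearMap.smul_apply]⟩

instance : IsScalarTower ℂ ℂ[X]ᵐᵒᵖ (SandwichAlgebra μ) :=
  ⟨fun c p x => by
    induction p using MulOpposite.rec' with
    | h p => simp only [← MulOpposite.op_smul, op_smul_def, map_smul, LinearMap.smul_apply]⟩

instance : SMulCommClass ℂ[X] ℂ[X]ᵐᵒᵖ (SandwichAlgebra μ) :=
  ⟨fun p q x => by
    induction q using MulOpposite.rec' with
    | h q =>
      induction x using induction with
      | zero => simp only [smul_zero]
      | add x y hx hy => simp only [smul_add, hx, hy]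
      | tmul a g b => simp only [op_smul_tmul, smul_tmul]⟩

instance : SMulCommClass ℂ ℂ[X] (SandwichAlgebra μ) :=
  ⟨fun c p x => by simp only [smul_def, map_smul]⟩

theorem op_smul_smul (p : ℂ[X]) (c : ℂ) (x : SandwichAlgebra μ) :
    MulOpposite.op p • c • x = c • MulOpposite.op p • x := by
  simp only [op_smul_def, map_smul]

/-- The functional `a ⊗ g ⊗ b ↦ μ(a b) ν(g)`. -/
noncomputable def trace (μ ν : NCDistribution) : SandwichAlgebra μ →ₗ[ℂ] ℂ :=
  μ ∘ₗ LinearMap.mul' ℂ ℂ[X] ∘ₗ LinearMap.lTensor ℂ[X]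
    ((TensorProduct.lid ℂ ℂ[X]).toLinearMap ∘ₗ LinearMap.rTensor ℂ[X] ν)

theorem trace_tmul (ν : NCDistribution) (a g b : ℂ[X]) :
    trace μ ν (tmul μ a g b) = μ (a * b) * ν g := by
  change μ (a * (ν g • b)) = _
  rw [mul_smul_comm, map_smul, smul_eq_mul, mul_comm]

theorem tmul_smul (c : ℂ) (a g b : ℂ[X]) : tmul μ a (c • g) b = c • tmul μ a g b := by
  simp only [tmul, ← TensorProduct.smul_tmul', TensorProduct.tmul_smul]
  rfl

theorem tmul_add (a g h b : ℂ[X]) : tmul μ a (g + h) b = tmul μ a g b + tmul μ a h b := by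
  simp only [tmul, TensorProduct.add_tmul, TensorProduct.tmul_add]
  rfl

/-- The noncommutative probability space of type B′ formed by `ℂ[x]` and the sandwich algebra. -/
noncomputable def space (μ ν : NCDistribution) (hμ : μ 1 = 1) : TypeBPrimeNCPS.{0, 0} where
  A := ℂ[X]
  F := SandwichAlgebra μ
  smul_mul p x y := by
    induction x using induction with
    | zero => simp only [smul_zero, zero_mul]
    | add x x' hx hx' => simp only [smul_add, add_mul, hx, hx']
    | tmul a g b =>
      induction y using induction with
      | zero => simp only [smul_zero, mul_zero]
      | add y y' hy hy' => simp only [smul_add, mul_add, hy, hy']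
      | tmul c h d => simp only [smul_tmul, tmul_mul_tmul, smul_comm p]
  mul_op_smul p x y := by
    induction x using induction with
    | zero => simp only [smul_zero, zero_mul]
    | add x x' hx hx' => simp only [smul_add, add_mul, hx, hx']
    | tmul a g b =>
      induction y using induction with
      | zero => simp only [smul_zero, mul_zero]
      | add y y' hy hy' => simp only [smul_add, mul_add, hy, hy']
      | tmul c h d => simp only [op_smul_tmul, tmul_mul_tmul, op_smul_smul]
  op_smul_mul p x y := by
    induction x using induction with
    | zero => simp only [smul_zero, zero_mul]
    | add x x' hx hx' => simp only [smul_add, add_mul, hx, hx']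
    | tmul a g b =>
      induction y using induction with
      | zero => simp only [smul_zero, mul_zero]
      | add y y' hy hy' => simp only [smul_add, mul_add, hy, hy']
      | tmul c h d => simp only [op_smul_tmul, smul_tmul, tmul_mul_tmul, mul_assoc]
  φ := μ
  φ_one := hμ
  Φ := trace μ ν

variable {ν : NCDistribution} {hμ : μ 1 = 1}

/-- Because `μ 1 = 1`, the map `g ↦ 1 ⊗ g ⊗ 1` is multiplicative, so its range is a subalgebra. -/
theorem exists_tmul_of_mem_adjoin (hμ : μ 1 = 1) {x : SandwichAlgebra μ}
    (hx : x ∈ NonUnitalAlgebra.adjoin ℂ {tmul μ 1 X 1}) : ∃ g, x = tmul μ 1 g 1 := by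
  induction hx using NonUnitalAlgebra.adjoin_induction with
  | mem x hx => exact ⟨X, hx⟩
  | zero => exact ⟨0, by simpa using (tmul_smul (μ := μ) 0 1 0 1).symm⟩
  | add x y _ _ hx hy =>
    obtain ⟨g, rfl⟩ := hx
    obtain ⟨h, rfl⟩ := hy
    exact ⟨g + h, (tmul_add _ _ _ _).symm⟩
  | mul x y _ _ hx hy =>
    obtain ⟨g, rfl⟩ := hx
    obtain ⟨h, rfl⟩ := hy
    exact ⟨g * h, by rw [tmul_mul_tmul, one_mul, hμ, one_smul]⟩
  | smul c x _ hx =>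
    obtain ⟨g, rfl⟩ := hx
    exact ⟨c • g, (tmul_smul _ _ _ _).symm⟩

/-- The embedding of `ℂ[x]`. -/
noncomputable def inA (ν : NCDistribution) (hμ : μ 1 = 1) (p : ℂ[X]) : (space μ ν hμ).Alg :=
  (space μ ν hμ).ofA p

/-- The embedding of the sandwich algebra. -/
noncomputable def inF (ν : NCDistribution) (hμ : μ 1 = 1) (x : SandwichAlgebra μ) :
    (space μ ν hμ).Alg :=
  (space μ ν hμ).ofF x

theorem inA_one : inA ν hμ 1 = 1 := rfl

theorem inA_mul_inF (p : ℂ[X]) (x : SandwichAlgebra μ) :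
    inA ν hμ p * inF ν hμ x = inF ν hμ (p • x) :=
  TypeBPrimeNCPS.ofA_mul_ofF (S := space μ ν hμ) p x

theorem inF_mul_inA (x : SandwichAlgebra μ) (p : ℂ[X]) :
    inF ν hμ x * inA ν hμ p = inF ν hμ (MulOpposite.op p • x) :=
  TypeBPrimeNCPS.ofF_mul_ofA (S := space μ ν hμ) x p

theorem inF_mul_inF (x y : SandwichAlgebra μ) : inF ν hμ x * inF ν hμ y = inF ν hμ (x * y) :=
  TypeBPrimeNCPS.ofF_mul_ofF (S := space μ ν hμ) x y

theorem trF_inF (x : SandwichAlgebra μ) : (space μ ν hμ).trF (inF ν hμ x) = trace μ ν x := rfl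

/-- Each interior `aₖ` stands between two contracted legs and becomes the scalar `μ(aₖ)`. Only the
two outermost elements survive as legs, and the trace later joins them. -/
theorem inA_mul_prod (n : ℕ) (a : Fin (n + 2) → ℂ[X]) (g : Fin (n + 1) → ℂ[X]) :
    inA ν hμ (a 0) * (List.ofFn fun k : Fin (n + 1) =>
        inF ν hμ (tmul μ 1 (g k) 1) * inA ν hμ (a k.succ)).prod =
      inF ν hμ ((∏ k : Fin n, μ (a k.succ.castSucc)) •
        tmul μ (a 0) (∏ k, g k) (a (Fin.last (n + 1)))) := by
  induction n with
  | zero =>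
    simp only [List.ofFn_succ, List.ofFn_zero, List.prod_cons, List.prod_nil, mul_one, inF_mul_inA,
      inA_mul_inF, op_smul_tmul, smul_tmul]
    simp
  | succ n ih =>
    have := ih (fun k => a k.succ) fun k => g k.succ
    rw [List.ofFn_succ, List.prod_cons, mul_assoc, this, inF_mul_inF, inA_mul_inF, mul_smul_comm,
      tmul_mul_tmul, smul_comm (a 0), smul_comm (a 0), smul_tmul, smul_smul, Fin.prod_univ_succ g,
      Fin.prod_univ_succ (fun k : Fin (n + 1) => μ (a k.succ.castSucc)), mul_one, one_mul,
      mul_comm (Finset.prod _ _)]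
    rfl

theorem prod_inF (n : ℕ) (g : Fin (n + 1) → ℂ[X]) :
    (List.ofFn fun k => inF ν hμ (tmul μ 1 (g k) 1)).prod = inF ν hμ (tmul μ 1 (∏ k, g k) 1) := by
  have := inA_mul_prod (ν := ν) (hμ := hμ) n (fun _ => 1) g
  simpa [inA_one, hμ] using this

theorem elemCyclicAntimonotone :
    (space μ ν hμ).ElemCyclicAntimonotone (X : ℂ[X]) (tmul μ 1 X 1) := by
  intro n (a : Fin (n + 2) → ℂ[X]) (f : Fin (n + 1) → SandwichAlgebra μ) _ hf
  choose g hg using fun k => exists_tmul_of_mem_adjoin hμ (hf k)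
  obtain rfl : f = fun k => tmul μ 1 (g k) 1 := funext hg
  change (space μ ν hμ).trF (inA ν hμ (a 0) * (List.ofFn fun k : Fin (n + 1) =>
      inF ν hμ (tmul μ 1 (g k) 1) * inA ν hμ (a k.succ)).prod) =
    μ (a 0 * a (Fin.last (n + 1))) * (∏ k : Fin n, μ (a k.succ.castSucc)) *
      (space μ ν hμ).trF (List.ofFn fun k => inF ν hμ (tmul μ 1 (g k) 1)).prod
  rw [inA_mul_prod, prod_inF, trF_inF, trF_inF, map_smul, trace_tmul, trace_tmul, mul_one, hμ,
    one_mul, smul_eq_mul]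
  ring

theorem distributionOf_inF (hν : ν 1 = 0) :
    distributionOf (space μ ν hμ).trF (inF ν hμ (tmul μ 1 X 1)) = ν := by
  refine NCDistribution.ext_moments fun n => ?_
  rw [distributionOf_X_pow]
  -- The moment of order zero is `φ'(1) = 0`, which is why `ν 1 = 0` is needed.
  rcases n with _ | n
  · rw [pow_zero, pow_zero, hν]
    exact (space μ ν hμ).toInf.φ'_one
  · have := prod_inF (ν := ν) (hμ := hμ) n fun _ => X
    rw [List.ofFn_const, List.prod_replicate, Finset.prod_const, Finset.card_univ,
      Fintype.card_fin] at this
    rw [this, trF_inF, trace_tmul, mul_one, hμ, one_mul]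

theorem isCyclicAntimonotoneConv (hμ : μ 1 = 1) (hν : ν 1 = 0) :
    IsCyclicAntimonotoneConv μ ν
      (distributionOf (space μ ν hμ).trF (inA ν hμ X + inF ν hμ (tmul μ 1 X 1))) :=
  ⟨space μ ν hμ, (X : ℂ[X]), tmul μ 1 X 1, elemCyclicAntimonotone,
    NCDistribution.ext_moments fun n => distributionOf_X_pow (B := ℂ[X]) μ X n,
    distributionOf_inF hν, rfl⟩

end SandwichAlgebra

end

/-! ### Comparison of the two convolutions -/

theorem IsCyclicAntimonotoneConv.cauchyTransform_eq {μ ν ρ : NCDistribution}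
    (h : IsCyclicAntimonotoneConv μ ν ρ) :
    cauchyTransform ρ = HahnSeries.ofPowerSeries ℤ ℂ (cyclicConvSeries μ ν) := by
  obtain ⟨S, a, f, hS, rfl, rfl, rfl⟩ := h
  exact hS.cauchyTransform_add

theorem IsInfFreeConv.cauchyTransform_eq {μ ν ρ : NCDistribution}
    (h : IsInfFreeConv 0 μ deltaZero ν ρ) :
    cauchyTransform ρ = HahnSeries.ofPowerSeries ℤ ℂ (cyclicConvSeries μ ν) := by
  obtain ⟨S, a, f, hS, ha, hf, rfl⟩ := h
  exact hS.cauchyTransform_add ha hf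

theorem IsCyclicAntimonotoneConv.isInfFreeConv {μ ν ρ : NCDistribution}
    (h : IsCyclicAntimonotoneConv μ ν ρ) : IsInfFreeConv 0 μ deltaZero ν ρ := by
  obtain ⟨S, a, f, hS, rfl, rfl, rfl⟩ := h
  exact ⟨S.toInf, S.ofA a, S.ofF f, hS.elemInfFree, TypeBPrimeNCPS.infDistribution_ofA a,
    TypeBPrimeNCPS.infDistribution_ofF f, rfl⟩

/-- The sandwich model supplies the existence without which `Classical.epsilon` would be an
arbitrary value. -/
theorem isCyclicAntimonotoneConv_cyclicAntimonotoneConv {μ ν : NCDistribution} (hμ : μ 1 = 1)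
    (hν : ν 1 = 0) : IsCyclicAntimonotoneConv μ ν (cyclicAntimonotoneConv μ ν) :=
  Classical.epsilon_spec ⟨_, SandwichAlgebra.isCyclicAntimonotoneConv hμ hν⟩

theorem isInfFreeConv_infFreeConv {μ ν : NCDistribution} (hμ : μ 1 = 1)
    (hν : ν 1 = 0) : IsInfFreeConv 0 μ deltaZero ν (infFreeConv 0 μ deltaZero ν) :=
  Classical.epsilon_spec ⟨_, (SandwichAlgebra.isCyclicAntimonotoneConv hμ hν).isInfFreeConv⟩

theorem corollary3p2 :
    -- the infinitesimal distribution of `a + f`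
    (∀ (S : TypeBPrimeNCPS.{u, v}) (a : S.A) (f : S.F) (μ ν : NCDistribution),
      S.ElemCyclicAntimonotone a f →
      distributionOf S.φ a = μ →
      distributionOf S.toInf.φ' (S.ofF f) = ν →
      S.toInf.infDistribution (S.ofA a + S.ofF f) = (μ, cyclicAntimonotoneConv μ ν)) ∧
    ∀ μ ν : NCDistribution, μ 1 = 1 → ν 1 = 0 →
      -- both convolutions exist and depend only on the given distributions
      (∀ ρ, IsCyclicAntimonotoneConv μ ν ρ ↔ ρ = cyclicAntimonotoneConv μ ν) ∧
      (∀ ρ, IsInfFreeConv 0 μ deltaZero ν ρ ↔ ρ = infFreeConv 0 μ deltaZero ν) ∧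
      cyclicAntimonotoneConv μ ν = infFreeConv 0 μ deltaZero ν ∧
      -- the characterization by formal Cauchy transforms
      cauchyTransform (cyclicAntimonotoneConv μ ν) =
        cauchyComp ν (reciprocalCauchy μ) * derivZ (reciprocalCauchy μ) ∧
      ∀ ρ : NCDistribution,
        cauchyTransform ρ = cauchyComp ν (reciprocalCauchy μ) * derivZ (reciprocalCauchy μ) →
        ρ = cyclicAntimonotoneConv μ ν := by
  refine ⟨?_, fun μ ν hμ hν => ?_⟩
  · rintro S a f μ ν h rfl rfl
    have hμ : distributionOf S.φ a 1 = 1 := by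
      rw [distributionOf_apply, map_one, S.φ_one]
    have hν : distributionOf S.toInf.φ' (S.ofF f) 1 = 0 :=
      (congrArg S.toInf.φ' (map_one (aeval (S.ofF f)))).trans S.toInf.φ'_one
    refine Prod.ext (TypeBPrimeNCPS.distributionOf_φ_ofA_add a f) (cauchyTransform_injective ?_)
    -- The space `S` lives in arbitrary universes, whereas the convolution is chosen among spaces in
    -- universe `0`. The two are therefore compared through their Cauchy transforms.
    exact h.cauchyTransform_add.trans
      (isCyclicAntimonotoneConv_cyclicAntimonotoneConv hμ hν).cauchyTransform_eq.symm
  · have hc := isCyclicAntimonotoneConv_cyclicAntimonotoneConv hμ hν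
    have hf := isInfFreeConv_infFreeConv hμ hν
    refine ⟨fun ρ => ⟨fun h => ?_, fun h => h ▸ hc⟩, fun ρ => ⟨fun h => ?_, fun h => h ▸ hf⟩, ?_, ?_,
      fun ρ h => ?_⟩
    · exact cauchyTransform_injective (h.cauchyTransform_eq.trans hc.cauchyTransform_eq.symm)
    · exact cauchyTransform_injective (h.cauchyTransform_eq.trans hf.cauchyTransform_eq.symm)
    · exact cauchyTransform_injective (hc.cauchyTransform_eq.trans hf.cauchyTransform_eq.symm)
    · rw [cauchyComp_mul_derivZ hμ hν, hc.cauchyTransform_eq]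
    · rw [cauchyComp_mul_derivZ hμ hν] at h
      exact cauchyTransform_injective (h.trans hc.cauchyTransform_eq.symm)
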